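/- Let $G$ be the number of multicast groups, $K_i$ the number of users in group $i$, $\gamma_{ik}>0$ the SINR target of user $k$ in group $i$ and $\sigma^2>0$ the noise variance, all independent of the number $N$ of antennas. For each user let $(h_{ik,n})_{n\ge 1}$ be a sequence of complex random variables, and let $\mathbf h_{ik}=[h_{ik,1},\dots,h_{ik,N}]^T$ be its channel vector to $N$ antennas. Put $\mathbf H_i=[\mathbf h_{i1},\dots,\mathbf h_{iK_i}]$ and, for $\boldsymbol\lambda=(\lambda_{ik})\succcurlyeq \mathbf 0$, $$\mathbf R(\boldsymbol\lambda)=\mathbf I+\sum_{i=1}^G\sum_{k=1}^{K_i}\lambda_{ik}\gamma_{ik}\,\mathbf h_{ik}\mathbf h_{ik}^H .$$ Write $\mathbf D_{\lambda_i}=\mathrm{diag}(\lambda_{i1},\dots,\lambda_{iK_i})$ and $\mathbf D_{\gamma_i}=\mathrm{diag}(\gamma_{i1},\dots,\gamma_{iK_i})$. Consider the QoS problem $$\min_{\mathbf w}\ \sum_{i=1}^G\|\mathbf w_i\|^2\quad\text{s.t.}\quad \frac{|\mathbf w_i^H\mathbf h_{ik}|^2}{\sum_{j\ne i}|\mathbf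 w_j^H\mathbf h_{ik}|^2+\sigma^2}\ \ge\ \gamma_{ik}\quad\text{for all } i,k .$$ For an optimal solution $\mathbf w^o$ of it, let $\delta_{ik}=\mathbf h_{ik}^H\mathbf w_i^o$ and $\boldsymbol\delta_i=[\delta_{i1},\dots,\delta_{iK_i}]^T$, and let $\boldsymbol\lambda^o$ be an optimal dual solution of the convex approximation of the problem at $\mathbf w^o$, that is, with $\mathbf z=\mathbf w^o$, a maximizer over $\boldsymbol\lambda\succcurlyeq\mathbf 0$ of $$g(\mathbf z,\boldsymbol\lambda)=\min_{\mathbf w}\ \sum_{i}\|\mathbf w_i\|^2+\sum_{i,k}\lambda_{ik}\Big[\gamma_{ik}\sum_{j\neq i}|\mathbf w_j^H\mathbf h_{ik}|^2-2\,\Re\{\mathbf w_i^H\mathbf h_{ik}\mathbf h_{ik}^H\mathbf z_i\}+|\mathbf z_i^H\mathbf h_{ik}|^2+\sigma^2\gamma_{ik}\Big].$$ **Proposition.** Assume that the channels $(h_{ik,n})_{n\ge1}$ of different users are independent, and that for each user the entries $h_{ik,n}$, $n\ge 1$, are i.i.d. and not almost surely zero, with $E(|h_{ik,n}|)<\infty$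 and $E(h_{ik,n})=0$. Then the following holds almost surely. 1. For all sufficiently large $N$, the fixed-point equations $$\lambda_{ik}(1+\gamma_{ik})\,\mathbf h_{ik}^H\mathbf R(\boldsymbol\lambda)^{-1}\mathbf h_{ik}=1\quad\text{for all } i,k$$ have exactly one solution $\boldsymbol\lambda=\boldsymbol\lambda^{(N)}\succcurlyeq\mathbf 0$. 2. This solution satisfies the optimality condition asymptotically: if, for all sufficiently large $N$, $\mathbf w^o=\mathbf w^{o,(N)}$ is an optimal solution of the QoS problem with $N$ antennas, then $$\big(\mathbf H_i^H\mathbf R(\boldsymbol\lambda^{(N)})^{-1}\mathbf H_i\mathbf D_{\lambda_i^{(N)}}(\mathbf I+\mathbf D_{\gamma_i})-\mathbf I\big)\boldsymbol\delta_i\ \to\ \mathbf 0\qquad (N\to\infty)\quad\text{for every } i .$$ 3. It is therefore asymptotically optimal: if moreover, for all sufficiently large $N$, $\boldsymbol\lambda^{o}=\boldsymbol\lambda^{o,(N)}$ is an optimal dual solution at $\mathbf w^{o,(N)}$, then $\lambda_{ik}^{(N)}/\lambda_{ik}^{o,(N)}\to 1$ as $N\to\infty$ for all $i,k$. -/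

import Mathlib

open MeasureTheory ProbabilityTheory Filter Topology

namespace Multicast

noncomputable section

/-! There are `G` groups, group `i` has `K i` users, and the base station has `N` antennas.
`h i k : Fin N → ℂ` is the channel vector of user `k` in group `i`, `γ i k` is the SINR target of
that user, `σ ^ 2` is the noise variance, and `w i : Fin N → ℂ` is the beamforming vector of
group `i`. Channel-dependent quantities are written for a fixed realization of the channels. -/

/-- `R(λ) = I + ∑ i, ∑ k, λ_{ik} γ_{ik} h_{ik} h_{ik}ᴴ`. -/
def covMatrix {G : ℕ} {K : Fin G → ℕ} {N : ℕ} (h : (i : Fin G) → Fin (K i) → Fin N → ℂ)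
    (γ lam : (i : Fin G) → Fin (K i) → ℝ) : Matrix (Fin N) (Fin N) ℂ :=
  1 + ∑ i, ∑ k, ((lam i k * γ i k : ℝ) : ℂ) • Matrix.vecMulVec (h i k) (star (h i k))

/-- `H_i = [h_{i1}, …, h_{iK_i}]`, the channel matrix of group `i`. -/
def groupMatrix {G : ℕ} {K : Fin G → ℕ} {N : ℕ} (h : (i : Fin G) → Fin (K i) → Fin N → ℂ)
    (i : Fin G) : Matrix (Fin N) (Fin (K i)) ℂ :=
  Matrix.of fun n k => h i k n

/-- `λ ≽ 0` solves the equations `λ_{ik} (1 + γ_{ik}) h_{ik}ᴴ R(λ)⁻¹ h_{ik} = 1` for all users. -/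
def IsFixedPointSolution {G : ℕ} {K : Fin G → ℕ} {N : ℕ}
    (h : (i : Fin G) → Fin (K i) → Fin N → ℂ) (γ lam : (i : Fin G) → Fin (K i) → ℝ) : Prop :=
  (∀ i k, 0 ≤ lam i k) ∧
    ∀ i k, ((lam i k * (1 + γ i k) : ℝ) : ℂ) *
      (star (h i k) ⬝ᵥ ((covMatrix h γ lam)⁻¹).mulVec (h i k)) = 1

/-- The left-hand side `(H_iᴴ R(λ)⁻¹ H_i D_{λ_i} (I + D_{γ_i}) - I) δ_i` of the optimality
condition for group `i`. -/
def optimalityResidual {G : ℕ} {K : Fin G → ℕ} {N : ℕ}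
    (h : (i : Fin G) → Fin (K i) → Fin N → ℂ) (γ lam : (i : Fin G) → Fin (K i) → ℝ)
    (i : Fin G) (δ : Fin (K i) → ℂ) : Fin (K i) → ℂ :=
  ((groupMatrix h i).conjTranspose * (covMatrix h γ lam)⁻¹ * groupMatrix h i *
      Matrix.diagonal (fun k => (lam i k : ℂ)) *
      (1 + Matrix.diagonal (fun k => (γ i k : ℂ))) - 1).mulVec δ

/-- The transmit power `∑ i, ‖w_i‖²` (Euclidean norm). -/
def power {G N : ℕ} (w : Fin G → Fin N → ℂ) : ℝ :=
  ∑ i, ∑ n, ‖w i n‖ ^ 2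

/-- The interference power `∑_{j ≠ i} |w_jᴴ h_{ik}|²` at user `k` of group `i`. -/
def interference {G : ℕ} {K : Fin G → ℕ} {N : ℕ} (h : (i : Fin G) → Fin (K i) → Fin N → ℂ)
    (w : Fin G → Fin N → ℂ) (i : Fin G) (k : Fin (K i)) : ℝ :=
  ∑ j ∈ Finset.univ.erase i, ‖star (w j) ⬝ᵥ h i k‖ ^ 2

/-- The received SINR at user `k` of group `i`. -/
def sinr {G : ℕ} {K : Fin G → ℕ} {N : ℕ} (h : (i : Fin G) → Fin (K i) → Fin N → ℂ)
    (σ : ℝ) (w : Fin G → Fin N → ℂ) (i : Fin G) (k : Fin (K i)) : ℝ :=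
  ‖star (w i) ⬝ᵥ h i k‖ ^ 2 / (interference h w i k + σ ^ 2)

/-- `w` is a (globally) optimal solution of the QoS problem: minimize `∑ i, ‖w_i‖²` subject to
`SINR_{ik} ≥ γ_{ik}` for all users. -/
def IsQoSOptimal {G : ℕ} {K : Fin G → ℕ} {N : ℕ} (h : (i : Fin G) → Fin (K i) → Fin N → ℂ)
    (γ : (i : Fin G) → Fin (K i) → ℝ) (σ : ℝ) (w : Fin G → Fin N → ℂ) : Prop :=
  (∀ i k, γ i k ≤ sinr h σ w i k) ∧
    ∀ v : Fin G → Fin N → ℂ, (∀ i k, γ i k ≤ sinr h σ v i k) → power w ≤ power v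

/-- The constraint function (required to be `≤ 0`) of user `k` in group `i` in the convex
approximation of the QoS problem at the point `z`. -/
def scaConstraint {G : ℕ} {K : Fin G → ℕ} {N : ℕ} (h : (i : Fin G) → Fin (K i) → Fin N → ℂ)
    (γ : (i : Fin G) → Fin (K i) → ℝ) (σ : ℝ) (z w : Fin G → Fin N → ℂ)
    (i : Fin G) (k : Fin (K i)) : ℝ :=
  γ i k * interference h w i k
    - 2 * ((star (w i) ⬝ᵥ h i k) * (star (h i k) ⬝ᵥ z i)).re
    + ‖star (z i) ⬝ᵥ h i k‖ ^ 2 + γ i k * σ ^ 2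

/-- The Lagrangian of the convex approximation at `z`. -/
def lagrangian {G : ℕ} {K : Fin G → ℕ} {N : ℕ} (h : (i : Fin G) → Fin (K i) → Fin N → ℂ)
    (γ : (i : Fin G) → Fin (K i) → ℝ) (σ : ℝ) (z w : Fin G → Fin N → ℂ)
    (lam : (i : Fin G) → Fin (K i) → ℝ) : ℝ :=
  power w + ∑ i, ∑ k, lam i k * scaConstraint h γ σ z w i k

/-- The dual function `g(z, λ) = min_w L(z, w, λ)` (for `λ ≽ 0` and `γ ≽ 0` the Lagrangian is
bounded below in `w`, so that the infimum is the genuine one). -/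
def dualFunction {G : ℕ} {K : Fin G → ℕ} {N : ℕ} (h : (i : Fin G) → Fin (K i) → Fin N → ℂ)
    (γ : (i : Fin G) → Fin (K i) → ℝ) (σ : ℝ) (z : Fin G → Fin N → ℂ)
    (lam : (i : Fin G) → Fin (K i) → ℝ) : ℝ :=
  ⨅ w : Fin G → Fin N → ℂ, lagrangian h γ σ z w lam

/-- `λ` is an optimal solution of the dual problem at `z`: maximize `g(z, λ)` over `λ ≽ 0`. -/
def IsDualOptimal {G : ℕ} {K : Fin G → ℕ} {N : ℕ} (h : (i : Fin G) → Fin (K i) → Fin N → ℂ)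
    (γ : (i : Fin G) → Fin (K i) → ℝ) (σ : ℝ) (z : Fin G → Fin N → ℂ)
    (lam : (i : Fin G) → Fin (K i) → ℝ) : Prop :=
  (∀ i k, 0 ≤ lam i k) ∧
    ∀ μ : (i : Fin G) → Fin (K i) → ℝ, (∀ i k, 0 ≤ μ i k) →
      dualFunction h γ σ z μ ≤ dualFunction h γ σ z lam

/-- The realization at `ω` of the channel vectors to `N` antennas: the entries `n < N` of the
random sequences `h i k`. -/
def channel {Ω : Type*} {G : ℕ} {K : Fin G → ℕ} (h : (i : Fin G) → Fin (K i) → ℕ → Ω → ℂ)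
    (ω : Ω) (N : ℕ) : (i : Fin G) → Fin (K i) → Fin N → ℂ :=
  fun i k n => h i k n ω

end

end Multicast

namespace Multicast

section StrongLaw

variable {Ω : Type*} [MeasurableSpace Ω] {P : Measure Ω} {ι : Type*} {X : ι → ℕ → Ω → ℂ}

lemma ae_tendsto_average_star_mul [IsProbabilityMeasure P]
    (hm : ∀ u n, Measurable (X u n))
    (hind : iIndepFun (fun (p : (_ : ι) × ℕ) ω => X p.1 p.2 ω) P)
    (hid : ∀ u n, IdentDistrib (X u n) (X u 0) P P)
    (hint : ∀ u n, Integrable (X u n) P) (hmean : ∀ u n, ∫ ω, X u n ω ∂P = 0)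
    {u v : ι} (huv : u ≠ v) :
    ∀ᵐ ω ∂P, Tendsto (fun N : ℕ => (N : ℝ)⁻¹ • ∑ n ∈ Finset.range N,
      star (X u n ω) * X v n ω) atTop (𝓝 0) := by
  have hpair : ∀ n, IndepFun (X u n) (X v n) P := fun n =>
    hind.indepFun (i := ⟨u, n⟩) (j := ⟨v, n⟩) (by simpa using huv)
  have hφ : Measurable (fun p : ℂ × ℂ => star p.1 * p.2) :=
    (continuous_star.comp continuous_fst |>.mul continuous_snd).measurable
  have hstar : ∀ n, IndepFun (fun ω => star (X u n ω)) (X v n) P := fun n =>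
    (hpair n).comp (φ := fun z : ℂ => star z) (ψ := id) continuous_star.measurable measurable_id
  have hstarint : ∀ n, Integrable (fun ω => star (X u n ω)) P := fun n => by
    refine (hint u n).congr' (continuous_star.comp_aestronglyMeasurable
      (hint u n).aestronglyMeasurable) (.of_forall fun ω => ?_)
    simp
  have key := strong_law_ae (μ := P) (fun n ω => star (X u n ω) * X v n ω)
    ((hstar 0).integrable_mul (hstarint 0) (hint v 0)) ?_ ?_
  · have h0 : P[fun ω => star (X u 0 ω) * X v 0 ω] = 0 := by
      have := (hstar 0).integral_fun_mul_eq_mul_integral (hstarint 0).aestronglyMeasurable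
        (hint v 0).aestronglyMeasurable
      rw [this, hmean v 0, mul_zero]
    rw [h0] at key
    exact key
  · intro n m hnm
    have := hind.indepFun_prodMk_prodMk (fun p => hm p.1 p.2) ⟨u, n⟩ ⟨v, n⟩ ⟨u, m⟩ ⟨v, m⟩
      (by simpa using hnm) (by simp [huv]) (by simp [huv.symm]) (by simpa using hnm)
    exact this.comp hφ hφ
  · intro n
    exact ((hid u n).prodMk (hid v n) (hpair n) (hpair 0)).comp hφ

lemma ae_tendsto_average_norm
    (hind : ∀ u, iIndepFun (X u) P)
    (hid : ∀ u n, IdentDistrib (X u n) (X u 0) P P)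
    (hint : ∀ u n, Integrable (X u n) P) (u : ι) :
    ∀ᵐ ω ∂P, Tendsto (fun N : ℕ => (N : ℝ)⁻¹ • ∑ n ∈ Finset.range N, ‖X u n ω‖) atTop
      (𝓝 (∫ ω, ‖X u 0 ω‖ ∂P)) := by
  refine strong_law_ae (μ := P) (fun n ω => ‖X u n ω‖) (hint u 0).norm ?_ ?_
  · intro n m hnm
    exact ((hind u).indepFun hnm).comp measurable_norm measurable_norm
  · intro n
    exact (hid u n).comp measurable_norm

lemma eventually_mul_le_sum_sq {x : ℕ → ℂ} {c : ℝ} (hc : 0 < c)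
    (hx : Tendsto (fun N : ℕ => (N : ℝ)⁻¹ • ∑ n ∈ Finset.range N, ‖x n‖) atTop (𝓝 c)) :
    ∀ᶠ N : ℕ in atTop, (c / 2) ^ 2 * N ≤ ∑ n ∈ Finset.range N, ‖x n‖ ^ 2 := by
  filter_upwards [hx.eventually_const_le (half_lt_self hc), eventually_gt_atTop 0] with N hN hpos
  have hN' : (0 : ℝ) < N := by exact_mod_cast hpos
  have h1 := sq_sum_le_card_mul_sum_sq (s := Finset.range N) (f := fun n => ‖x n‖)
  rw [Finset.card_range] at h1
  have h2 : c / 2 * N ≤ ∑ n ∈ Finset.range N, ‖x n‖ := by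
    rw [smul_eq_mul, inv_mul_eq_div, le_div_iff₀ hN'] at hN
    exact hN
  have h3 : (c / 2 * N) ^ 2 ≤ N * ∑ n ∈ Finset.range N, ‖x n‖ ^ 2 :=
    (pow_le_pow_left₀ (by positivity) h2 2).trans h1
  have h4 : N * ((c / 2) ^ 2 * N) ≤ N * ∑ n ∈ Finset.range N, ‖x n‖ ^ 2 := by
    refine le_trans (le_of_eq ?_) h3
    ring
  exact le_of_mul_le_mul_left h4 hN'

/-- Almost surely, the channel energies grow at least linearly and the normalized correlations of
different channels vanish asymptotically. -/
theorem ae_tendsto_normalized_gram [IsProbabilityMeasure P] [Countable ι]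
    (hm : ∀ u n, Measurable (X u n))
    (hindep : iIndepFun (fun u ω (n : ℕ) => X u n ω) P) (hind : ∀ u, iIndepFun (X u) P)
    (hid : ∀ u n, IdentDistrib (X u n) (X u 0) P P)
    (hint : ∀ u n, Integrable (X u n) P) (hmean : ∀ u n, ∫ ω, X u n ω ∂P = 0)
    (hne : ∀ u, ¬ (X u 0 =ᵐ[P] 0)) :
    ∀ᵐ ω ∂P, (∀ u, ∀ᶠ N in atTop, 0 < ∑ n ∈ Finset.range N, ‖X u n ω‖ ^ 2) ∧
      ∀ u v, u ≠ v → Tendsto (fun N => (∑ n ∈ Finset.range N, star (X u n ω) * X v n ω) /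
        ((∑ n ∈ Finset.range N, ‖X v n ω‖ ^ 2 : ℝ) : ℂ)) atTop (𝓝 0) := by
  have hunc := iIndepFun_uncurry (P := P) (X := X) hm hindep hind
  have hcpos : ∀ u, 0 < ∫ ω, ‖X u 0 ω‖ ∂P := fun u => by
    refine lt_of_le_of_ne (integral_nonneg fun _ => norm_nonneg _) fun h0 => hne u ?_
    have := (integral_eq_zero_iff_of_nonneg (fun _ => norm_nonneg _) (hint u 0).norm).1 h0.symm
    filter_upwards [this] with ω hω
    simpa using hω
  have h1 : ∀ᵐ ω ∂P, ∀ u, Tendsto (fun N : ℕ => (N : ℝ)⁻¹ • ∑ n ∈ Finset.range N, ‖X u n ω‖)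
      atTop (𝓝 (∫ ω, ‖X u 0 ω‖ ∂P)) :=
    ae_all_iff.2 fun u => ae_tendsto_average_norm hind hid hint u
  have h2 : ∀ᵐ ω ∂P, ∀ u v, u ≠ v → Tendsto (fun N : ℕ => (N : ℝ)⁻¹ • ∑ n ∈ Finset.range N,
      star (X u n ω) * X v n ω) atTop (𝓝 0) := by
    refine ae_all_iff.2 fun u => ae_all_iff.2 fun v => ?_
    by_cases huv : u = v
    · exact .of_forall fun ω h => absurd huv h
    · filter_upwards [ae_tendsto_average_star_mul hm hunc hid hint hmean huv] with ω hω _ using hω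
  filter_upwards [h1, h2] with ω hω1 hω2
  have hlow := fun u => eventually_mul_le_sum_sq (hcpos u) (hω1 u)
  refine ⟨fun u => ?_, fun u v huv => ?_⟩
  · filter_upwards [hlow u, eventually_gt_atTop 0] with N hN hpos
    refine lt_of_lt_of_le ?_ hN
    have := hcpos u
    positivity
  · set c := ∫ ω, ‖X v 0 ω‖ ∂P with hc
    have hc0 : 0 < c := hcpos v
    have hz : Tendsto (fun N : ℕ => ((c / 2) ^ 2)⁻¹ * ‖(N : ℝ)⁻¹ • ∑ n ∈ Finset.range N,
        star (X u n ω) * X v n ω‖) atTop (𝓝 0) := by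
      simpa using (hω2 u v huv).norm.const_mul (((c / 2) ^ 2)⁻¹)
    refine squeeze_zero_norm' ?_ hz
    filter_upwards [hlow v, eventually_gt_atTop 0] with N hN hpos
    have hN' : (0 : ℝ) < N := by exact_mod_cast hpos
    rw [norm_div, norm_smul, Complex.norm_real, Real.norm_of_nonneg
      (Finset.sum_nonneg fun _ _ => by positivity), Real.norm_of_nonneg (by positivity),
      ← mul_assoc, ← mul_inv, inv_mul_eq_div]
    exact div_le_div_of_nonneg_left (norm_nonneg _) (by positivity) hN

end StrongLaw

section QuadraticForm

variable {N : ℕ} {ι : Type*} [Fintype ι]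

/-- The squared Euclidean norm of a complex vector. -/
noncomputable def energy (w : Fin N → ℂ) : ℝ := ∑ n, ‖w n‖ ^ 2

/-- The matrix `I + ∑ u, a_u h_u h_uᴴ`. -/
noncomputable def weightedCov (H : ι → Fin N → ℂ) (a : ι → ℝ) : Matrix (Fin N) (Fin N) ℂ :=
  1 + ∑ u, (a u : ℂ) • Matrix.vecMulVec (H u) (star (H u))

/-- The quadratic form `‖w‖² + ∑ u, a_u |h_uᴴ w|²` of `weightedCov H a`. -/
noncomputable def quadForm (H : ι → Fin N → ℂ) (a : ι → ℝ) (w : Fin N → ℂ) : ℝ :=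
  energy w + ∑ u, a u * ‖star (H u) ⬝ᵥ w‖ ^ 2

lemma energy_nonneg (w : Fin N → ℂ) : 0 ≤ energy w :=
  Finset.sum_nonneg fun _ _ => by positivity

lemma energy_eq_zero {w : Fin N → ℂ} (hw : energy w = 0) : w = 0 := by
  funext n
  have := (Finset.sum_eq_zero_iff_of_nonneg (fun _ _ => by positivity)).1 hw n (Finset.mem_univ n)
  simpa using this

lemma energy_pos {w : Fin N → ℂ} (hw : w ≠ 0) : 0 < energy w :=
  lt_of_le_of_ne (energy_nonneg w) fun h => hw (energy_eq_zero h.symm)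

lemma star_dotProduct_self (w : Fin N → ℂ) : star w ⬝ᵥ w = (energy w : ℂ) := by
  simp only [dotProduct, energy, Complex.ofReal_sum, Pi.star_apply]
  refine Finset.sum_congr rfl fun n _ => ?_
  rw [RCLike.star_def, Complex.conj_mul']
  push_cast
  rfl

lemma star_dotProduct_comm (x y : Fin N → ℂ) : star x ⬝ᵥ y = star (star y ⬝ᵥ x) := by
  rw [Matrix.star_dotProduct, dotProduct_comm]

lemma norm_star_dotProduct_comm (x y : Fin N → ℂ) : ‖star x ⬝ᵥ y‖ = ‖star y ⬝ᵥ x‖ := by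
  rw [star_dotProduct_comm, norm_star]

lemma norm_add_sq_complex (a b : ℂ) :
    ‖a + b‖ ^ 2 = ‖a‖ ^ 2 + 2 * (star a * b).re + ‖b‖ ^ 2 := by
  simp only [Complex.sq_norm, Complex.normSq_apply, Complex.add_re, Complex.add_im,
    Complex.mul_re, Complex.star_def, Complex.conj_re, Complex.conj_im]
  ring

lemma energy_add (x y : Fin N → ℂ) :
    energy (x + y) = energy x + 2 * (star x ⬝ᵥ y).re + energy y := by
  simp only [energy, dotProduct, Complex.re_sum, Finset.mul_sum, Pi.add_apply, norm_add_sq_complex,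
    Finset.sum_add_distrib, Pi.star_apply]

lemma energy_smul (c : ℂ) (w : Fin N → ℂ) : energy (c • w) = ‖c‖ ^ 2 * energy w := by
  simp [energy, Finset.mul_sum, mul_pow]

lemma norm_sq_dotProduct_le (x y : Fin N → ℂ) :
    ‖star x ⬝ᵥ y‖ ^ 2 ≤ energy x * energy y := by
  have h1 : ‖star x ⬝ᵥ y‖ ≤ ∑ n, ‖x n‖ * ‖y n‖ := by
    refine (norm_sum_le _ _).trans (le_of_eq ?_)
    simp
  exact (pow_le_pow_left₀ (norm_nonneg _) h1 2).trans (Finset.sum_mul_sq_le_sq_mul_sq _ _ _)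

lemma weightedCov_mulVec (H : ι → Fin N → ℂ) (a : ι → ℝ) (w : Fin N → ℂ) :
    (weightedCov H a).mulVec w = w + ∑ u, ((a u : ℂ) * (star (H u) ⬝ᵥ w)) • H u := by
  rw [weightedCov, Matrix.add_mulVec, Matrix.one_mulVec, Matrix.sum_mulVec]
  congr 1
  refine Finset.sum_congr rfl fun u _ => ?_
  rw [Matrix.smul_mulVec, Matrix.vecMulVec_mulVec]
  ext n
  simp [mul_comm, mul_left_comm]

lemma star_dotProduct_weightedCov_mulVec (H : ι → Fin N → ℂ) (a : ι → ℝ) (x y : Fin N → ℂ) :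
    star x ⬝ᵥ (weightedCov H a).mulVec y =
      star x ⬝ᵥ y + ∑ u, (a u : ℂ) * (star (star (H u) ⬝ᵥ x) * (star (H u) ⬝ᵥ y)) := by
  rw [weightedCov_mulVec, dotProduct_add, dotProduct_sum]
  congr 1
  refine Finset.sum_congr rfl fun u _ => ?_
  rw [dotProduct_smul, ← star_dotProduct_comm, smul_eq_mul]
  ring

lemma quadForm_add (H : ι → Fin N → ℂ) (a : ι → ℝ) (x y : Fin N → ℂ) :
    quadForm H a (x + y) =
      quadForm H a x + 2 * (star x ⬝ᵥ (weightedCov H a).mulVec y).re + quadForm H a y := by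
  rw [star_dotProduct_weightedCov_mulVec]
  simp only [quadForm, energy_add, dotProduct_add, norm_add_sq_complex, Complex.add_re,
    Complex.re_sum, Complex.re_ofReal_mul, mul_add, Finset.sum_add_distrib]
  have : ∑ u, a u * (2 * (star (star (H u) ⬝ᵥ x) * (star (H u) ⬝ᵥ y)).re) =
      2 * ∑ u, a u * (star (star (H u) ⬝ᵥ x) * (star (H u) ⬝ᵥ y)).re := by
    rw [Finset.mul_sum]
    exact Finset.sum_congr rfl fun u _ => by ring
  rw [this]
  ring

lemma star_dotProduct_weightedCov_mulVec_self (H : ι → Fin N → ℂ) (a : ι → ℝ) (x : Fin N → ℂ) :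
    star x ⬝ᵥ (weightedCov H a).mulVec x = (quadForm H a x : ℂ) := by
  rw [star_dotProduct_weightedCov_mulVec, star_dotProduct_self, quadForm]
  push_cast
  congr 1
  refine Finset.sum_congr rfl fun u _ => ?_
  rw [RCLike.star_def, Complex.conj_mul']

lemma quadForm_smul (H : ι → Fin N → ℂ) (a : ι → ℝ) (c : ℂ) (w : Fin N → ℂ) :
    quadForm H a (c • w) = ‖c‖ ^ 2 * quadForm H a w := by
  simp only [quadForm, energy_smul, dotProduct_smul, smul_eq_mul, norm_mul, mul_pow, mul_add,
    Finset.mul_sum]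
  congr 1
  exact Finset.sum_congr rfl fun u _ => by ring

variable {H : ι → Fin N → ℂ} {a : ι → ℝ}

lemma energy_le_quadForm (ha : ∀ u, 0 ≤ a u) (w : Fin N → ℂ) : energy w ≤ quadForm H a w :=
  le_add_of_nonneg_right (Finset.sum_nonneg fun u _ => mul_nonneg (ha u) (by positivity))

lemma quadForm_nonneg (ha : ∀ u, 0 ≤ a u) (w : Fin N → ℂ) : 0 ≤ quadForm H a w :=
  (energy_nonneg w).trans (energy_le_quadForm ha w)

lemma quadForm_mono {b : ι → ℝ} (hab : ∀ u, a u ≤ b u) (w : Fin N → ℂ) :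
    quadForm H a w ≤ quadForm H b w := by
  unfold quadForm
  gcongr with u
  exact hab u

lemma isUnit_weightedCov (ha : ∀ u, 0 ≤ a u) : IsUnit (weightedCov H a).det := by
  rw [isUnit_iff_ne_zero]
  intro h0
  obtain ⟨w, hw, hw0⟩ := Matrix.exists_mulVec_eq_zero_iff.2 h0
  have h1 := star_dotProduct_weightedCov_mulVec_self H a w
  rw [hw0, dotProduct_zero] at h1
  have h2 : quadForm H a w = 0 := by exact_mod_cast h1.symm
  exact absurd (energy_pos hw) (not_lt.2 ((energy_le_quadForm ha w).trans h2.le))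

lemma weightedCov_mulVec_inv (ha : ∀ u, 0 ≤ a u) (v : Fin N → ℂ) :
    (weightedCov H a).mulVec ((weightedCov H a)⁻¹.mulVec v) = v := by
  rw [Matrix.mulVec_mulVec, Matrix.mul_nonsing_inv _ (isUnit_weightedCov ha), Matrix.one_mulVec]

/-- Completing the square. -/
lemma quadForm_sub_two_re (y : Fin N → ℂ) (w : Fin N → ℂ) :
    quadForm H a w - 2 * (star w ⬝ᵥ (weightedCov H a).mulVec y).re =
      quadForm H a (w - y) - quadForm H a y := by
  have h1 := quadForm_add H a (w - y) y
  rw [sub_add_cancel, star_sub, sub_dotProduct, star_dotProduct_weightedCov_mulVec_self,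
    Complex.sub_re, Complex.ofReal_re] at h1
  linarith

lemma star_dotProduct_inv_mulVec (ha : ∀ u, 0 ≤ a u) (v : Fin N → ℂ) :
    star v ⬝ᵥ (weightedCov H a)⁻¹.mulVec v =
      (quadForm H a ((weightedCov H a)⁻¹.mulVec v) : ℂ) := by
  have h1 := star_dotProduct_weightedCov_mulVec_self H a ((weightedCov H a)⁻¹.mulVec v)
  rw [weightedCov_mulVec_inv ha] at h1
  rw [star_dotProduct_comm, h1]
  simp

lemma quadForm_inv_mulVec_pos (ha : ∀ u, 0 ≤ a u) {v : Fin N → ℂ} (hv : v ≠ 0) :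
    0 < quadForm H a ((weightedCov H a)⁻¹.mulVec v) := by
  refine (energy_pos fun h0 => hv ?_).trans_le (energy_le_quadForm ha _)
  rw [← weightedCov_mulVec_inv (H := H) ha v, h0, Matrix.mulVec_zero]

/-- `1 / (vᴴ R⁻¹ v)` is a lower bound for `wᴴ R w` subject to `vᴴ w = 1`. -/
lemma inv_quadForm_le (ha : ∀ u, 0 ≤ a u) {v w : Fin N → ℂ} (hw : star v ⬝ᵥ w = 1) :
    (quadForm H a ((weightedCov H a)⁻¹.mulVec v))⁻¹ ≤ quadForm H a w := by
  have hv : v ≠ 0 := by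
    rintro rfl
    simp at hw
  set y := (weightedCov H a)⁻¹.mulVec v with hy
  set p := quadForm H a y with hp
  have hp0 : 0 < p := quadForm_inv_mulVec_pos ha hv
  have h1 := quadForm_sub_two_re (H := H) (a := a) (((p⁻¹ : ℝ) : ℂ) • y) w
  rw [Matrix.mulVec_smul, hy, weightedCov_mulVec_inv ha, ← hy, dotProduct_smul,
    star_dotProduct_comm, hw, quadForm_smul, ← hp, Complex.norm_real, Real.norm_of_nonneg
    (by positivity)] at h1
  have h2 := quadForm_nonneg (H := H) ha (w - ((p⁻¹ : ℝ) : ℂ) • y)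
  have h3 : p⁻¹ ^ 2 * p = p⁻¹ := by field_simp
  simp only [star_one, smul_eq_mul, mul_one, Complex.ofReal_re] at h1
  linarith

/-- The bound `inv_quadForm_le` is attained. -/
lemma exists_quadForm_eq_inv (ha : ∀ u, 0 ≤ a u) {v : Fin N → ℂ} (hv : v ≠ 0) :
    ∃ w, star v ⬝ᵥ w = 1 ∧
      quadForm H a w = (quadForm H a ((weightedCov H a)⁻¹.mulVec v))⁻¹ := by
  have h1 := star_dotProduct_inv_mulVec (H := H) ha v
  have hp0 := quadForm_inv_mulVec_pos (H := H) ha hv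
  set y := (weightedCov H a)⁻¹.mulVec v
  set p := quadForm H a y with hp
  have hp1 : (p : ℂ) ≠ 0 := by exact_mod_cast hp0.ne'
  refine ⟨((p⁻¹ : ℝ) : ℂ) • y, ?_, ?_⟩
  · rw [dotProduct_smul, h1, smul_eq_mul, Complex.ofReal_inv, inv_mul_cancel₀ hp1]
  · rw [quadForm_smul, ← hp, Complex.norm_real, Real.norm_of_nonneg (by positivity)]
    field_simp

end QuadraticForm

section FixedPoint

variable {N : ℕ} {ι : Type*} [Fintype ι] {H : ι → Fin N → ℂ} {γ lam : ι → ℝ}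

/-- The fixed-point equations for a family of channels indexed by an arbitrary finite type. -/
def IsFixedPoint (H : ι → Fin N → ℂ) (γ lam : ι → ℝ) : Prop :=
  (∀ u, 0 ≤ lam u) ∧ ∀ u, ((lam u * (1 + γ u) : ℝ) : ℂ) *
    (star (H u) ⬝ᵥ (weightedCov H fun v => lam v * γ v)⁻¹.mulVec (H u)) = 1

lemma isFixedPoint_iff (hγ : ∀ u, 0 < γ u) (hH : ∀ u, H u ≠ 0) :
    IsFixedPoint H γ lam ↔ (∀ u, 0 ≤ lam u) ∧ ∀ u, lam u * (1 + γ u) =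
      (quadForm H (fun v => lam v * γ v)
        ((weightedCov H fun v => lam v * γ v)⁻¹.mulVec (H u)))⁻¹ := by
  refine and_congr_right fun h0 => forall_congr' fun u => ?_
  have ha : ∀ v, 0 ≤ lam v * γ v := fun v => mul_nonneg (h0 v) (hγ v).le
  rw [star_dotProduct_inv_mulVec ha, ← mul_eq_one_iff_eq_inv₀ (quadForm_inv_mulVec_pos ha (hH u)).ne']
  norm_cast

lemma IsFixedPoint.ne_zero (h : IsFixedPoint H γ lam) (u : ι) : H u ≠ 0 := by
  intro h0
  have := h.2 u
  simp [h0] at this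

lemma IsFixedPoint.pos (h : IsFixedPoint H γ lam) (u : ι) : 0 < lam u := by
  refine lt_of_le_of_ne (h.1 u) fun h0 => ?_
  have := h.2 u
  simp [← h0] at this

lemma IsFixedPoint.le_quadForm (hγ : ∀ u, 0 < γ u) (h : IsFixedPoint H γ lam) {u : ι}
    {w : Fin N → ℂ} (hw : star (H u) ⬝ᵥ w = 1) :
    lam u * (1 + γ u) ≤ quadForm H (fun v => lam v * γ v) w := by
  rw [((isFixedPoint_iff hγ h.ne_zero).1 h).2 u]
  exact inv_quadForm_le (fun v => mul_nonneg (h.1 v) (hγ v).le) hw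

lemma IsFixedPoint.exists_quadForm_eq (hγ : ∀ u, 0 < γ u) (h : IsFixedPoint H γ lam) (u : ι) :
    ∃ w, star (H u) ⬝ᵥ w = 1 ∧ quadForm H (fun v => lam v * γ v) w = lam u * (1 + γ u) := by
  rw [((isFixedPoint_iff hγ h.ne_zero).1 h).2 u]
  exact exists_quadForm_eq_inv (fun v => mul_nonneg (h.1 v) (hγ v).le) (h.ne_zero u)

lemma IsFixedPoint.le (hγ : ∀ u, 0 < γ u) {μ : ι → ℝ} (hl : IsFixedPoint H γ lam)
    (hm : IsFixedPoint H γ μ) : μ ≤ lam := by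
  intro u₀
  have : Nonempty ι := ⟨u₀⟩
  obtain ⟨u, hu⟩ := Finite.exists_max fun v => μ v / lam v
  set α := μ u / lam u with hα
  have hle : ∀ v, μ v ≤ α * lam v := fun v => (div_le_iff₀ (hl.pos v)).1 (hu v)
  by_cases hα1 : α ≤ 1
  · exact (hle u₀).trans (mul_le_of_le_one_left (hl.1 u₀) hα1)
  exfalso
  push Not at hα1
  obtain ⟨w, hw, hq⟩ := hl.exists_quadForm_eq hγ u
  have hw0 : w ≠ 0 := by
    rintro rfl
    simp at hw
  have h1 := hm.le_quadForm hγ hw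
  have h2 : quadForm H (fun v => μ v * γ v) w ≤ quadForm H (fun v => α * lam v * γ v) w :=
    quadForm_mono (fun v => mul_le_mul_of_nonneg_right (hle v) (hγ v).le) w
  have h3 : quadForm H (fun v => α * lam v * γ v) w =
      α * quadForm H (fun v => lam v * γ v) w - (α - 1) * energy w := by
    simp only [quadForm, mul_add, Finset.mul_sum, mul_assoc]
    ring
  have h4 : μ u = α * lam u := by rw [hα, div_mul_cancel₀ _ (hl.pos u).ne']
  have h5 : 0 < (α - 1) * energy w := mul_pos (by linarith) (energy_pos hw0)
  rw [h3, hq] at h2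
  rw [h4] at h1
  nlinarith

lemma quadForm_dual [DecidableEq ι] {d : ι → Fin N → ℂ}
    (hd : ∀ u v, star (H v) ⬝ᵥ d u = if v = u then 1 else 0) (a : ι → ℝ) (u : ι) :
    quadForm H a (d u) = energy (d u) + a u := by
  simp [quadForm, hd, apply_ite norm]

lemma IsFixedPoint.le_energy_dual [DecidableEq ι] (hγ : ∀ u, 0 < γ u) (h : IsFixedPoint H γ lam)
    {d : ι → Fin N → ℂ} (hd : ∀ u v, star (H v) ⬝ᵥ d u = if v = u then 1 else 0) (u : ι) :
    lam u ≤ energy (d u) := by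
  have := h.le_quadForm hγ (u := u) (w := d u) (by simp [hd])
  rw [quadForm_dual hd] at this
  linarith

lemma IsFixedPoint.one_le_mul_energy (hγ : ∀ u, 0 < γ u) (h : IsFixedPoint H γ lam) (u : ι) :
    1 ≤ lam u * energy (H u) := by
  obtain ⟨w, hw, hq⟩ := h.exists_quadForm_eq hγ u
  have h1 : energy w + lam u * γ u ≤ quadForm H (fun v => lam v * γ v) w := by
    have := Finset.single_le_sum (f := fun v => lam v * γ v * ‖star (H v) ⬝ᵥ w‖ ^ 2)
      (fun v _ => mul_nonneg (mul_nonneg (h.1 v) (hγ v).le) (by positivity)) (Finset.mem_univ u)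
    simp only [hw, norm_one, one_pow, mul_one] at this
    unfold quadForm
    linarith
  have h2 := norm_sq_dotProduct_le (H u) w
  rw [hw, norm_one, one_pow] at h2
  have h3 : energy w ≤ lam u := by linarith
  nlinarith [energy_nonneg (H u)]

/-- Existence of a solution of the fixed-point equations, by monotonicity. -/
lemma exists_isFixedPoint [DecidableEq ι] (hγ : ∀ u, 0 < γ u) {d : ι → Fin N → ℂ}
    (hd : ∀ u v, star (H v) ⬝ᵥ d u = if v = u then 1 else 0) :
    ∃ lam, IsFixedPoint H γ lam := by
  have hH : ∀ u, H u ≠ 0 := fun u h0 => by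
    have := hd u u
    simp [h0] at this
  set S : (ι → ℝ) → ι → ℝ := fun x u => (1 + γ u)⁻¹ *
    (quadForm H (fun v => x v * γ v) ((weightedCov H fun v => x v * γ v)⁻¹.mulVec (H u)))⁻¹ with hS
  have hpos : ∀ x : ι → ℝ, 0 ≤ x → ∀ v, 0 ≤ x v * γ v := fun x hx v => mul_nonneg (hx v) (hγ v).le
  have hS0 : ∀ x, 0 ≤ x → 0 ≤ S x := fun x hx u => mul_nonneg
    (by have := hγ u; positivity) (inv_nonneg.2 (quadForm_nonneg (hpos x hx) _))
  have hSle : ∀ x, 0 ≤ x → ∀ u w, star (H u) ⬝ᵥ w = 1 →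
      S x u ≤ (1 + γ u)⁻¹ * quadForm H (fun v => x v * γ v) w := fun x hx u w hw =>
    mul_le_mul_of_nonneg_left (inv_quadForm_le (hpos x hx) hw) (by have := hγ u; positivity)
  have hSmono : ∀ x y, 0 ≤ x → x ≤ y → S x ≤ S y := fun x y hx hxy u => by
    obtain ⟨w, hw, hq⟩ := exists_quadForm_eq_inv (H := H) (hpos y (hx.trans hxy)) (hH u)
    refine (hSle x hx u w hw).trans ?_
    simp only [hS, ← hq]
    refine mul_le_mul_of_nonneg_left (quadForm_mono (fun v => ?_) w)
      (by have := hγ u; positivity)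
    exact mul_le_mul_of_nonneg_right (hxy v) (hγ v).le
  set b : ι → ℝ := fun u => energy (d u) with hb
  have hb0 : 0 ≤ b := fun u => energy_nonneg _
  have hSb : S b ≤ b := fun u => by
    refine (hSle b hb0 u (d u) (by simp [hd])).trans (le_of_eq ?_)
    rw [quadForm_dual hd]
    have : 1 + γ u ≠ 0 := by have := hγ u; positivity
    simp only [hb]
    field_simp
  set A : Set (ι → ℝ) := {x | 0 ≤ x ∧ x ≤ b ∧ x ≤ S x} with hA
  have hA0 : (0 : ι → ℝ) ∈ A := ⟨le_rfl, hb0, hS0 0 le_rfl⟩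
  have hAb : BddAbove A := ⟨b, fun x hx => hx.2.1⟩
  set x := sSup A with hx
  have hx0 : 0 ≤ x := le_csSup hAb hA0
  have hxb : x ≤ b := csSup_le ⟨0, hA0⟩ fun y hy => hy.2.1
  have hxS : x ≤ S x := csSup_le ⟨0, hA0⟩ fun y hy =>
    hy.2.2.trans (hSmono y x hy.1 (le_csSup hAb hy))
  have hSx : S x ≤ x := le_csSup hAb ⟨hS0 x hx0, (hSmono x b hx0 hxb).trans hSb,
    hSmono x (S x) hx0 hxS⟩
  refine ⟨x, (isFixedPoint_iff hγ hH).2 ⟨hx0, fun u => ?_⟩⟩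
  have h1 : x u = S x u := congrFun (le_antisymm hxS hSx) u
  have : 1 + γ u ≠ 0 := by have := hγ u; positivity
  rw [h1]
  simp only [hS]
  field_simp

lemma existsUnique_isFixedPoint [DecidableEq ι] (hγ : ∀ u, 0 < γ u) {d : ι → Fin N → ℂ}
    (hd : ∀ u v, star (H v) ⬝ᵥ d u = if v = u then 1 else 0) :
    ∃! lam, IsFixedPoint H γ lam := by
  obtain ⟨lam, hlam⟩ := exists_isFixedPoint hγ hd
  exact ⟨lam, hlam, fun μ hμ => le_antisymm (hlam.le hγ hμ) (hμ.le hγ hlam)⟩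

end FixedPoint

section DualVectors

variable {N : ℕ} {ι : Type*} [Fintype ι] [DecidableEq ι] {H : ι → Fin N → ℂ}

/-- The column-normalized Gram matrix `h_uᴴ h_v / ‖h_v‖²`. -/
noncomputable def normGram (H : ι → Fin N → ℂ) : Matrix ι ι ℂ :=
  Matrix.of fun u v => (star (H u) ⬝ᵥ H v) / (energy (H v) : ℂ)

/-- The family biorthogonal to `H`. -/
noncomputable def dualVec (H : ι → Fin N → ℂ) (u : ι) : Fin N → ℂ :=
  ∑ v, star ((normGram H)⁻¹ u v / (energy (H u) : ℂ)) • H v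

lemma star_dualVec_dotProduct (u : ι) (x : Fin N → ℂ) :
    star (dualVec H u) ⬝ᵥ x =
      (∑ v, (normGram H)⁻¹ u v * (star (H v) ⬝ᵥ x)) / (energy (H u) : ℂ) := by
  rw [dualVec, star_sum, sum_dotProduct, Finset.sum_div]
  refine Finset.sum_congr rfl fun v _ => ?_
  rw [star_smul, star_star, smul_dotProduct, smul_eq_mul]
  ring

lemma energy_mul_star_dualVec_dotProduct (hs : ∀ u, 0 < energy (H u)) (u : ι) (x : Fin N → ℂ) :
    (energy (H u) : ℂ) * (star (dualVec H u) ⬝ᵥ x) =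
      ∑ v, (normGram H)⁻¹ u v * (star (H v) ⬝ᵥ x) := by
  have : (energy (H u) : ℂ) ≠ 0 := by exact_mod_cast (hs u).ne'
  rw [star_dualVec_dotProduct, mul_div_cancel₀ _ this]

lemma star_dualVec_dotProduct_apply (hs : ∀ u, 0 < energy (H u)) (hM : IsUnit (normGram H).det)
    (u v : ι) : star (dualVec H u) ⬝ᵥ H v = if v = u then 1 else 0 := by
  have hne : ∀ u, (energy (H u) : ℂ) ≠ 0 := fun u => by exact_mod_cast (hs u).ne'
  have h1 := congrFun (congrFun (Matrix.nonsing_inv_mul _ hM) u) v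
  rw [Matrix.mul_apply] at h1
  have h2 : ∀ j, star (H j) ⬝ᵥ H v = normGram H j v * (energy (H v) : ℂ) := fun j => by
    rw [normGram, Matrix.of_apply, div_mul_cancel₀ _ (hne v)]
  simp only [star_dualVec_dotProduct, h2, ← mul_assoc, ← Finset.sum_mul, h1, Matrix.one_apply]
  by_cases huv : u = v
  · subst huv
    simp [hne u]
  · simp [huv, Ne.symm huv]

lemma star_dotProduct_dualVec (hs : ∀ u, 0 < energy (H u)) (hM : IsUnit (normGram H).det)
    (u v : ι) : star (H v) ⬝ᵥ dualVec H u = if v = u then 1 else 0 := by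
  rw [star_dotProduct_comm, star_dualVec_dotProduct_apply hs hM]
  split_ifs <;> simp

lemma energy_mul_energy_dualVec (hs : ∀ u, 0 < energy (H u)) (hM : IsUnit (normGram H).det)
    (u : ι) : ((energy (H u) * energy (dualVec H u) : ℝ) : ℂ) = (normGram H)⁻¹ u u := by
  have h1 := energy_mul_star_dualVec_dotProduct hs u (dualVec H u)
  rw [star_dotProduct_self] at h1
  push_cast
  rw [h1]
  simp [star_dotProduct_dualVec hs hM]

/-- A matrix identity for `h_uᴴ R⁻¹ h_v`, in terms of the normalized Gram matrix. -/
lemma inv_normGram_add_mul (hs : ∀ u, 0 < energy (H u)) (hM : IsUnit (normGram H).det)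
    {γ lam : ι → ℝ} (hlam : ∀ u, 0 ≤ lam u * γ u) :
    ((normGram H)⁻¹ + Matrix.diagonal fun u => ((lam u * energy (H u) * γ u : ℝ) : ℂ)) *
      (Matrix.of fun u v => (lam v : ℂ) *
        (star (H u) ⬝ᵥ (weightedCov H fun j => lam j * γ j)⁻¹.mulVec (H v))) =
      Matrix.diagonal fun u => ((lam u * energy (H u) : ℝ) : ℂ) := by
  ext u v
  have h1 := weightedCov_mulVec_inv (H := H) hlam (H v)
  set y := (weightedCov H fun j => lam j * γ j)⁻¹.mulVec (H v) with hy
  rw [weightedCov_mulVec] at h1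
  have h2 := congrArg (fun z => star (dualVec H u) ⬝ᵥ z) h1
  simp only [dotProduct_add, dotProduct_sum, dotProduct_smul, smul_eq_mul,
    star_dualVec_dotProduct_apply hs hM, mul_ite, mul_one, mul_zero, Finset.sum_ite_eq',
    Finset.mem_univ, if_true] at h2
  have h3 := energy_mul_star_dualVec_dotProduct hs u y
  rw [Matrix.add_mul, Matrix.add_apply, Matrix.mul_apply, Matrix.diagonal_mul,
    Matrix.diagonal_apply]
  simp only [Matrix.of_apply, ← hy]
  have h4 : ∑ j, (normGram H)⁻¹ u j * ((lam v : ℂ) * (star (H j) ⬝ᵥ y)) =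
      (lam v : ℂ) * ((energy (H u) : ℂ) * (star (dualVec H u) ⬝ᵥ y)) := by
    rw [h3, Finset.mul_sum]
    exact Finset.sum_congr rfl fun j _ => by ring
  rw [h4, eq_sub_of_add_eq h2]
  by_cases huv : u = v
  · subst huv
    simp only [if_true]
    push_cast
    ring
  · simp only [huv, Ne.symm huv, if_false]
    push_cast
    ring

end DualVectors

section Limits

variable {ι : Type*} [Fintype ι] [DecidableEq ι] {H : (N : ℕ) → ι → Fin N → ℂ}

lemma tendsto_matrix_inv {α : Type*} {l : Filter α} {M : α → Matrix ι ι ℂ} {A : Matrix ι ι ℂ}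
    (hM : Tendsto M l (𝓝 A)) (hA : IsUnit A.det) : Tendsto (fun x => (M x)⁻¹) l (𝓝 A⁻¹) := by
  obtain ⟨c, hc⟩ := hA
  exact (continuousAt_matrix_inv A (hc ▸ NormedRing.inverse_continuousAt c)).tendsto.comp hM

lemma eventually_isUnit_det {α : Type*} {l : Filter α} {M : α → Matrix ι ι ℂ}
    (hM : Tendsto M l (𝓝 1)) : ∀ᶠ x in l, IsUnit (M x).det := by
  have h1 : Tendsto (fun x => (M x).det) l (𝓝 (1 : Matrix ι ι ℂ).det) :=
    (continuous_id.matrix_det.tendsto _).comp hM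
  rw [Matrix.det_one] at h1
  filter_upwards [h1.eventually_ne one_ne_zero] with x hx using isUnit_iff_ne_zero.2 hx

lemma tendsto_inv_normGram (hM : Tendsto (fun N => normGram (H N)) atTop (𝓝 1)) :
    Tendsto (fun N => (normGram (H N))⁻¹) atTop (𝓝 1) := by
  simpa using tendsto_matrix_inv hM (by simp)

lemma tendsto_matrix_apply {α κ : Type*} {l : Filter α} {M : α → Matrix κ κ ℂ}
    {A : Matrix κ κ ℂ} (hM : Tendsto M l (𝓝 A)) (u v : κ) : Tendsto (fun x => M x u v) l (𝓝 (A u v)) :=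
  tendsto_pi_nhds.1 (tendsto_pi_nhds.1 hM u) v

lemma tendsto_energy_mul_energy_dualVec (hs : ∀ᶠ N in atTop, ∀ u, 0 < energy (H N u))
    (hM : Tendsto (fun N => normGram (H N)) atTop (𝓝 1)) (u : ι) :
    Tendsto (fun N => energy (H N u) * energy (dualVec (H N) u)) atTop (𝓝 1) := by
  have h1 := (Complex.continuous_re.tendsto _).comp
    (tendsto_matrix_apply (tendsto_inv_normGram hM) u u)
  rw [Matrix.one_apply_eq, Complex.one_re] at h1
  refine h1.congr' ?_
  filter_upwards [hs, eventually_isUnit_det hM] with N hN hdet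
  rw [Function.comp_apply, ← energy_mul_energy_dualVec hN hdet, Complex.ofReal_re]

variable {γ : ι → ℝ} {lam : ℕ → ι → ℝ}

/-- The normalized solutions of the fixed-point equations converge to `1`. -/
lemma tendsto_fixedPoint_mul_energy (hγ : ∀ u, 0 < γ u)
    (hs : ∀ᶠ N in atTop, ∀ u, 0 < energy (H N u))
    (hM : Tendsto (fun N => normGram (H N)) atTop (𝓝 1))
    (hlam : ∀ᶠ N in atTop, IsFixedPoint (H N) γ (lam N)) (u : ι) :
    Tendsto (fun N => lam N u * energy (H N u)) atTop (𝓝 1) := by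
  refine tendsto_of_tendsto_of_tendsto_of_le_of_le' tendsto_const_nhds
    (tendsto_energy_mul_energy_dualVec hs hM u) ?_ ?_
  · filter_upwards [hlam] with N hN using hN.one_le_mul_energy hγ u
  · filter_upwards [hlam, hs, eventually_isUnit_det hM] with N hN hsN hdet
    rw [mul_comm]
    exact mul_le_mul_of_nonneg_left (hN.le_energy_dual hγ (star_dotProduct_dualVec hsN hdet) u)
      (hsN u).le

lemma tendsto_mul_star_dotProduct_inv (hγ : ∀ u, 0 < γ u)
    (hs : ∀ᶠ N in atTop, ∀ u, 0 < energy (H N u))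
    (hM : Tendsto (fun N => normGram (H N)) atTop (𝓝 1))
    (hlam : ∀ᶠ N in atTop, IsFixedPoint (H N) γ (lam N)) (u v : ι) :
    Tendsto (fun N => (star (H N u) ⬝ᵥ
        (weightedCov (H N) fun j => lam N j * γ j)⁻¹.mulVec (H N v)) *
      ((lam N v : ℂ) * (1 + γ v))) atTop (𝓝 (if u = v then 1 else 0)) := by
  have hx := fun u => tendsto_fixedPoint_mul_energy hγ hs hM hlam u
  have hxc : Tendsto (fun N => Matrix.diagonal fun u => ((lam N u * energy (H N u) : ℝ) : ℂ))
      atTop (𝓝 (1 : Matrix ι ι ℂ)) := by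
    rw [← Matrix.diagonal_one]
    refine (continuous_id.matrix_diagonal.tendsto _).comp (tendsto_pi_nhds.2 fun u => ?_)
    exact (Complex.continuous_ofReal.tendsto' 1 1 Complex.ofReal_one).comp (hx u)
  set A : Matrix ι ι ℂ := Matrix.diagonal fun u => 1 + (γ u : ℂ) with hA
  have hne : ∀ u, 1 + (γ u : ℂ) ≠ 0 := fun u => by
    have := hγ u
    exact_mod_cast (by positivity : (1 + γ u) ≠ 0)
  have hAdet : IsUnit A.det := by
    rw [hA, Matrix.det_diagonal, isUnit_iff_ne_zero]
    exact Finset.prod_ne_zero_iff.2 fun u _ => hne u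
  set T : ℕ → Matrix ι ι ℂ := fun N => (normGram (H N))⁻¹ +
    Matrix.diagonal fun u => ((lam N u * energy (H N u) * γ u : ℝ) : ℂ) with hT
  have hTA : Tendsto T atTop (𝓝 A) := by
    have hAeq : A = 1 + Matrix.diagonal fun u => ((1 * γ u : ℝ) : ℂ) := by
      rw [hA, ← Matrix.diagonal_one, Matrix.diagonal_add]
      simp
    rw [hAeq]
    refine (tendsto_inv_normGram hM).add ((continuous_id.matrix_diagonal.tendsto _).comp
      (tendsto_pi_nhds.2 fun u => ?_))
    exact (Complex.continuous_ofReal.tendsto _).comp ((hx u).mul_const (γ u))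
  have hTdet : ∀ᶠ N in atTop, IsUnit (T N).det := by
    have h1 : Tendsto (fun N => (T N).det) atTop (𝓝 A.det) :=
      (continuous_id.matrix_det.tendsto _).comp hTA
    filter_upwards [h1.eventually_ne hAdet.ne_zero] with N hN using isUnit_iff_ne_zero.2 hN
  have hlim := ((tendsto_matrix_inv hTA hAdet).mul hxc)
  have hAinv : A⁻¹ = Matrix.diagonal fun u => (1 + (γ u : ℂ))⁻¹ := by
    refine Matrix.inv_eq_right_inv ?_
    rw [hA, Matrix.diagonal_mul_diagonal, ← Matrix.diagonal_one]
    congr 1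
    funext u
    exact mul_inv_cancel₀ (hne u)
  rw [mul_one, hAinv] at hlim
  have hent := (tendsto_matrix_apply hlim u v).mul_const (1 + (γ v : ℂ))
  have hval : Matrix.diagonal (fun u => (1 + (γ u : ℂ))⁻¹) u v * (1 + (γ v : ℂ)) =
      if u = v then 1 else 0 := by
    rw [Matrix.diagonal_apply]
    split_ifs with huv
    · rw [huv, inv_mul_cancel₀ (hne v)]
    · rw [zero_mul]
  rw [hval] at hent
  refine hent.congr' ?_
  filter_upwards [hs, eventually_isUnit_det hM, hTdet, hlam] with N hsN hMN hTN hN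
  rw [← inv_normGram_add_mul hsN hMN (fun u => mul_nonneg (hN.1 u) (hγ u).le), ← Matrix.mul_assoc,
    Matrix.nonsing_inv_mul _ hTN, Matrix.one_mul, Matrix.of_apply]
  ring

end Limits

section Saddle

/-- If the value of `L₁` at a strict minimizer `x₀` is not improved by the infimum of any mixture
of `L₁` and `L₂`, then `L₂ x₀ ≤ L₁ x₀`. -/
lemma le_of_iInf_mix_le {E : Type*} [TopologicalSpace E] {L₁ L₂ : E → ℝ} {x₀ : E} {B : ℝ}
    (hmin : ∀ x, L₁ x₀ ≤ L₁ x)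
    (hgrow : ∀ V ∈ 𝓝 x₀, ∃ ε > 0, ∀ x ∉ V, L₁ x₀ + ε ≤ L₁ x)
    (hcont : ContinuousAt L₂ x₀) (hB : ∀ x, B ≤ L₂ x)
    (hinf : ∀ t : ℝ, 0 < t → t < 1 → ⨅ x, ((1 - t) * L₁ x + t * L₂ x) ≤ L₁ x₀) :
    L₂ x₀ ≤ L₁ x₀ := by
  by_contra! hlt
  obtain ⟨ε, hε, hV⟩ := hgrow {x | (L₁ x₀ + L₂ x₀) / 2 < L₂ x}
    (hcont.eventually_const_lt (by linarith))
  set D := ε + |B - L₁ x₀| with hD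
  have hDpos : 0 < D := by positivity
  set t := ε / (2 * D) with ht
  have ht0 : 0 < t := by positivity
  have htD : t * D = ε / 2 := by
    rw [ht]
    field_simp
  have ht1 : t < 1 := by
    rw [ht, div_lt_one (by positivity)]
    linarith [abs_nonneg (B - L₁ x₀)]
  set η := min (t * ((L₂ x₀ - L₁ x₀) / 2)) (ε / 2) with hη
  have hηpos : 0 < η := lt_min (mul_pos ht0 (by linarith)) (by positivity)
  have : Nonempty E := ⟨x₀⟩
  have hlow : L₁ x₀ + η ≤ ⨅ x, ((1 - t) * L₁ x + t * L₂ x) := by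
    refine le_ciInf fun x => ?_
    by_cases hx : (L₁ x₀ + L₂ x₀) / 2 < L₂ x
    · have h1 : (1 - t) * L₁ x₀ ≤ (1 - t) * L₁ x :=
        mul_le_mul_of_nonneg_left (hmin x) (by linarith)
      have h2 : t * ((L₁ x₀ + L₂ x₀) / 2) ≤ t * L₂ x := mul_le_mul_of_nonneg_left hx.le ht0.le
      have h3 : η ≤ t * ((L₂ x₀ - L₁ x₀) / 2) := min_le_left _ _
      linarith
    · have h1 : (1 - t) * (L₁ x₀ + ε) ≤ (1 - t) * L₁ x :=
        mul_le_mul_of_nonneg_left (hV x hx) (by linarith)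
      have h2 : t * B ≤ t * L₂ x := mul_le_mul_of_nonneg_left (hB x) ht0.le
      have h3 : η ≤ ε / 2 := min_le_right _ _
      have h4 : t * (-|B - L₁ x₀|) ≤ t * (B - L₁ x₀) :=
        mul_le_mul_of_nonneg_left (neg_abs_le _) ht0.le
      rw [hD] at htD
      linarith
  linarith [hinf t ht0 ht1]

end Saddle

section Duality

variable {G : ℕ} {K : Fin G → ℕ} {N : ℕ} {h : (i : Fin G) → Fin (K i) → Fin N → ℂ}
  {γ : (i : Fin G) → Fin (K i) → ℝ} {σ : ℝ} {z : Fin G → Fin N → ℂ}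
  {lam : (i : Fin G) → Fin (K i) → ℝ}

/-- The channels as a family indexed by all users. -/
def userChannel (h : (i : Fin G) → Fin (K i) → Fin N → ℂ) (u : (i : Fin G) × Fin (K i)) :
    Fin N → ℂ := h u.1 u.2

lemma covMatrix_eq (h : (i : Fin G) → Fin (K i) → Fin N → ℂ)
    (γ lam : (i : Fin G) → Fin (K i) → ℝ) :
    covMatrix h γ lam = weightedCov (userChannel h) fun u => lam u.1 u.2 * γ u.1 u.2 := by
  rw [covMatrix, weightedCov, Fintype.sum_sigma]
  rfl

lemma isFixedPointSolution_iff : IsFixedPointSolution h γ lam ↔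
    IsFixedPoint (userChannel h) (fun u => γ u.1 u.2) (fun u => lam u.1 u.2) := by
  simp only [IsFixedPointSolution, IsFixedPoint, covMatrix_eq, Sigma.forall]
  rfl

/-- The weights of the interference that the beam of group `j` causes to the other groups. -/
def leakWeight (γ lam : (i : Fin G) → Fin (K i) → ℝ) (j : Fin G)
    (u : (i : Fin G) × Fin (K i)) : ℝ :=
  if u.1 = j then 0 else lam u.1 u.2 * γ u.1 u.2

/-- The right-hand side of the stationarity condition of group `j`. -/
noncomputable def matchedSum (h : (i : Fin G) → Fin (K i) → Fin N → ℂ) (z : Fin G → Fin N → ℂ)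
    (lam : (i : Fin G) → Fin (K i) → ℝ) (j : Fin G) : Fin N → ℂ :=
  ∑ k, ((lam j k : ℂ) * (star (h j k) ⬝ᵥ z j)) • h j k

lemma leakWeight_nonneg (hγ : ∀ i k, 0 < γ i k) (hlam : ∀ i k, 0 ≤ lam i k) (j : Fin G)
    (u : (i : Fin G) × Fin (K i)) : 0 ≤ leakWeight γ lam j u := by
  unfold leakWeight
  split_ifs
  · exact le_rfl
  · exact mul_nonneg (hlam _ _) (hγ _ _).le

lemma sum_interference_eq (w : Fin G → Fin N → ℂ) :
    ∑ i, ∑ k, lam i k * (γ i k * interference h w i k) =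
      ∑ j, ∑ u, leakWeight γ lam j u * ‖star (userChannel h u) ⬝ᵥ w j‖ ^ 2 := by
  rw [Finset.sum_comm, Fintype.sum_sigma]
  refine Finset.sum_congr rfl fun i _ => Finset.sum_congr rfl fun k _ => ?_
  rw [← Finset.sum_erase (s := Finset.univ) (a := i) (by simp [leakWeight]), interference,
    ← mul_assoc, Finset.mul_sum]
  refine Finset.sum_congr rfl fun j hj => ?_
  rw [leakWeight, if_neg (Finset.ne_of_mem_erase hj).symm, norm_star_dotProduct_comm]
  rfl

lemma lagrangian_eq (w : Fin G → Fin N → ℂ) :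
    lagrangian h γ σ z w lam =
      ∑ j, (quadForm (userChannel h) (leakWeight γ lam j) (w j) -
        2 * (star (w j) ⬝ᵥ matchedSum h z lam j).re) +
      ∑ i, ∑ k, lam i k * (‖star (z i) ⬝ᵥ h i k‖ ^ 2 + γ i k * σ ^ 2) := by
  have h1 : ∀ j, 2 * (star (w j) ⬝ᵥ matchedSum h z lam j).re =
      ∑ k, lam j k * (2 * ((star (w j) ⬝ᵥ h j k) * (star (h j k) ⬝ᵥ z j)).re) := fun j => by
    rw [matchedSum, dotProduct_sum, Complex.re_sum, Finset.mul_sum]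
    refine Finset.sum_congr rfl fun k _ => ?_
    rw [dotProduct_smul, smul_eq_mul, mul_assoc, Complex.re_ofReal_mul,
      mul_comm (star (h j k) ⬝ᵥ z j)]
    ring
  simp only [quadForm, Finset.sum_sub_distrib, Finset.sum_add_distrib, h1, ← sum_interference_eq]
  have h2 : power w = ∑ j, energy (w j) := rfl
  rw [lagrangian, h2]
  simp only [scaConstraint, mul_add, mul_sub, Finset.sum_sub_distrib, Finset.sum_add_distrib]
  ring

lemma power_eq (w : Fin G → Fin N → ℂ) : power w = ∑ j, energy (w j) := rfl

/-- The Lagrangian has a minimizer, characterized by linear equations, and grows quadratically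
around it. -/
lemma exists_lagrangian_minimizer (hγ : ∀ i k, 0 < γ i k) (hlam : ∀ i k, 0 ≤ lam i k) :
    ∃ y : Fin G → Fin N → ℂ,
      (∀ j, (weightedCov (userChannel h) (leakWeight γ lam j)).mulVec (y j) =
        matchedSum h z lam j) ∧
      ∀ w, lagrangian h γ σ z y lam + power (w - y) ≤ lagrangian h γ σ z w lam := by
  have hnn := leakWeight_nonneg hγ hlam
  refine ⟨fun j => (weightedCov (userChannel h) (leakWeight γ lam j))⁻¹.mulVec
    (matchedSum h z lam j), fun j => weightedCov_mulVec_inv (hnn j) _, fun w => ?_⟩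
  set y : Fin G → Fin N → ℂ := fun j =>
    (weightedCov (userChannel h) (leakWeight γ lam j))⁻¹.mulVec (matchedSum h z lam j) with hy
  have hcov : ∀ j, (weightedCov (userChannel h) (leakWeight γ lam j)).mulVec (y j) =
      matchedSum h z lam j := fun j => weightedCov_mulVec_inv (hnn j) _
  rw [lagrangian_eq, lagrangian_eq, power_eq, add_right_comm, ← Finset.sum_add_distrib]
  refine add_le_add (Finset.sum_le_sum fun j _ => ?_) le_rfl
  rw [← hcov j, quadForm_sub_two_re, quadForm_sub_two_re, sub_self]
  have h1 := energy_le_quadForm (H := userChannel h) (hnn j) (w j - y j)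
  have h2 : quadForm (userChannel h) (leakWeight γ lam j) 0 = 0 := by simp [quadForm, energy]
  rw [h2, Pi.sub_apply]
  linarith

lemma power_nonneg (w : Fin G → Fin N → ℂ) : 0 ≤ power w :=
  Finset.sum_nonneg fun j _ => energy_nonneg (w j)

lemma power_eq_zero {w : Fin G → Fin N → ℂ} (hw : power w = 0) : w = 0 := by
  rw [power_eq] at hw
  funext j
  exact energy_eq_zero ((Finset.sum_eq_zero_iff_of_nonneg fun i _ => energy_nonneg (w i)).1 hw j
    (Finset.mem_univ j))

lemma exists_pos_le_power {y : Fin G → Fin N → ℂ} {V : Set (Fin G → Fin N → ℂ)} (hV : V ∈ 𝓝 y) :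
    ∃ ε > 0, ∀ w ∉ V, ε ≤ power (w - y) := by
  obtain ⟨r, hr, hball⟩ := Metric.mem_nhds_iff.1 hV
  refine ⟨r ^ 2, by positivity, fun w hw => ?_⟩
  have h1 : ∃ j n, r ≤ ‖w j n - y j n‖ := by
    by_contra! hcon
    refine hw (hball ?_)
    rw [Metric.mem_ball, dist_pi_lt_iff hr]
    intro j
    rw [dist_pi_lt_iff hr]
    intro n
    rw [dist_eq_norm]
    exact hcon j n
  obtain ⟨j, n, hjn⟩ := h1
  calc r ^ 2 ≤ ‖w j n - y j n‖ ^ 2 := pow_le_pow_left₀ hr.le hjn 2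
    _ ≤ energy ((w - y) j) := Finset.single_le_sum (f := fun n => ‖(w - y) j n‖ ^ 2)
        (fun _ _ => by positivity) (Finset.mem_univ n)
    _ ≤ power (w - y) := Finset.single_le_sum (f := fun j => energy ((w - y) j))
        (fun _ _ => energy_nonneg _) (Finset.mem_univ j)

lemma continuous_lagrangian : Continuous fun w => lagrangian h γ σ z w lam := by
  simp only [lagrangian, power, scaConstraint, interference, dotProduct, Pi.star_apply]
  fun_prop

lemma lagrangian_mix (μ : (i : Fin G) → Fin (K i) → ℝ) (t : ℝ) (w : Fin G → Fin N → ℂ) :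
    lagrangian h γ σ z w (fun i k => (1 - t) * lam i k + t * μ i k) =
      (1 - t) * lagrangian h γ σ z w lam + t * lagrangian h γ σ z w μ := by
  simp only [lagrangian, add_mul, mul_add, Finset.sum_add_distrib, Finset.mul_sum, mul_assoc]
  ring

lemma dualFunction_eq {y : Fin G → Fin N → ℂ}
    (hy : ∀ w, lagrangian h γ σ z y lam + power (w - y) ≤ lagrangian h γ σ z w lam) :
    dualFunction h γ σ z lam = lagrangian h γ σ z y lam := by
  have hle : ∀ w, lagrangian h γ σ z y lam ≤ lagrangian h γ σ z w lam := fun w =>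
    (le_add_of_nonneg_right (power_nonneg _)).trans (hy w)
  exact le_antisymm (ciInf_le ⟨_, Set.forall_mem_range.2 hle⟩ y) (le_ciInf hle)

/-- At the Lagrangian minimizer of an optimal dual solution, no other multiplier increases the
Lagrangian. -/
lemma IsDualOptimal.lagrangian_le (hγ : ∀ i k, 0 < γ i k) (hopt : IsDualOptimal h γ σ z lam)
    {y : Fin G → Fin N → ℂ}
    (hy : ∀ w, lagrangian h γ σ z y lam + power (w - y) ≤ lagrangian h γ σ z w lam)
    {μ : (i : Fin G) → Fin (K i) → ℝ} (hμ : ∀ i k, 0 ≤ μ i k) :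
    lagrangian h γ σ z y μ ≤ lagrangian h γ σ z y lam := by
  obtain ⟨x, -, hx⟩ := exists_lagrangian_minimizer (h := h) (σ := σ) (z := z) hγ hμ
  refine le_of_iInf_mix_le (L₁ := fun w => lagrangian h γ σ z w lam)
    (L₂ := fun w => lagrangian h γ σ z w μ) (B := lagrangian h γ σ z x μ)
    (fun w => (le_add_of_nonneg_right (power_nonneg _)).trans (hy w)) (fun V hV => ?_)
    continuous_lagrangian.continuousAt
    (fun w => (le_add_of_nonneg_right (power_nonneg _)).trans (hx w)) (fun t ht0 ht1 => ?_)
  · obtain ⟨ε, hε, hεV⟩ := exists_pos_le_power hV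
    exact ⟨ε, hε, fun w hw => by linarith [hy w, hεV w hw]⟩
  · have h1 := hopt.2 (fun i k => (1 - t) * lam i k + t * μ i k) fun i k =>
      add_nonneg (mul_nonneg (by linarith) (hopt.1 i k)) (mul_nonneg ht0.le (hμ i k))
    rw [dualFunction_eq hy, dualFunction] at h1
    simpa only [lagrangian_mix] using h1

lemma interference_nonneg (w : Fin G → Fin N → ℂ) (i : Fin G) (k : Fin (K i)) :
    0 ≤ interference h w i k :=
  Finset.sum_nonneg fun _ _ => by positivity

lemma le_sinr_iff (hσ : 0 < σ) {w : Fin G → Fin N → ℂ} {i : Fin G} {k : Fin (K i)} :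
    γ i k ≤ sinr h σ w i k ↔
      γ i k * (interference h w i k + σ ^ 2) ≤ ‖star (w i) ⬝ᵥ h i k‖ ^ 2 := by
  have := interference_nonneg (h := h) w i k
  rw [sinr, le_div_iff₀ (by positivity)]

lemma two_mul_re_mul_star_sub_le (a q : ℂ) : 2 * (a * star q).re - ‖q‖ ^ 2 ≤ ‖a‖ ^ 2 := by
  have h1 := norm_add_sq_complex (-q) a
  have h2 : (star (-q) * a).re = -(a * star q).re := by
    rw [star_neg, neg_mul, Complex.neg_re, mul_comm]
  rw [h2, norm_neg] at h1
  nlinarith [sq_nonneg ‖-q + a‖]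

lemma le_sinr_of_scaConstraint_nonpos (hσ : 0 < σ) {w : Fin G → Fin N → ℂ} {i : Fin G}
    {k : Fin (K i)} (hw : scaConstraint h γ σ z w i k ≤ 0) : γ i k ≤ sinr h σ w i k := by
  rw [le_sinr_iff hσ]
  have h1 := two_mul_re_mul_star_sub_le (star (w i) ⬝ᵥ h i k) (star (z i) ⬝ᵥ h i k)
  rw [← star_dotProduct_comm] at h1
  unfold scaConstraint at hw
  linarith

lemma scaConstraint_self_nonpos (hσ : 0 < σ) {i : Fin G} {k : Fin (K i)}
    (hz : γ i k ≤ sinr h σ z i k) : scaConstraint h γ σ z z i k ≤ 0 := by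
  rw [le_sinr_iff hσ] at hz
  have h1 : ((star (z i) ⬝ᵥ h i k) * (star (h i k) ⬝ᵥ z i)).re = ‖star (z i) ⬝ᵥ h i k‖ ^ 2 := by
    rw [star_dotProduct_comm (h i k), RCLike.star_def, Complex.mul_conj']
    norm_cast
  rw [scaConstraint, h1]
  linarith

/-- Strong duality for the convex approximation at an optimal solution of the QoS problem: the
optimal solution satisfies the stationarity conditions of every optimal dual solution. -/
theorem IsQoSOptimal.stationary (hγ : ∀ i k, 0 < γ i k) (hσ : 0 < σ)
    (hz : IsQoSOptimal h γ σ z) (hopt : IsDualOptimal h γ σ z lam) (j : Fin G) :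
    (weightedCov (userChannel h) (leakWeight γ lam j)).mulVec (z j) = matchedSum h z lam j := by
  obtain ⟨y, hcov, hy⟩ := exists_lagrangian_minimizer (h := h) (σ := σ) (z := z) hγ hopt.1
  have hfeas : ∀ i k, scaConstraint h γ σ z y i k ≤ 0 := fun i k => by
    have h1 := hopt.lagrangian_le hγ hy
      (μ := fun i' k' => lam i' k' + if (⟨i', k'⟩ : (i : Fin G) × Fin (K i)) = ⟨i, k⟩ then 1 else 0)
      (fun i' k' => add_nonneg (hopt.1 i' k') (by split_ifs <;> simp))
    have h2 : ∑ i', ∑ k', (if (⟨i', k'⟩ : (i : Fin G) × Fin (K i)) = ⟨i, k⟩ then (1 : ℝ) else 0) *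
        scaConstraint h γ σ z y i' k' = scaConstraint h γ σ z y i k := by
      rw [← Fintype.sum_sigma (fun u : (i : Fin G) × Fin (K i) =>
        (if u = ⟨i, k⟩ then (1 : ℝ) else 0) * scaConstraint h γ σ z y u.1 u.2)]
      simp
    simp only [lagrangian, add_mul, Finset.sum_add_distrib, h2] at h1
    linarith
  have hslack : 0 ≤ ∑ i, ∑ k, lam i k * scaConstraint h γ σ z y i k := by
    have h1 := hopt.lagrangian_le hγ hy (μ := fun _ _ => 0) (fun _ _ => le_rfl)
    simp only [lagrangian, zero_mul, Finset.sum_const_zero] at h1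
    linarith
  have hzy : power z ≤ power y := hz.2 y fun i k => le_sinr_of_scaConstraint_nonpos hσ (hfeas i k)
  have hLz : ∑ i, ∑ k, lam i k * scaConstraint h γ σ z z i k ≤ 0 :=
    Finset.sum_nonpos fun i _ => Finset.sum_nonpos fun k _ =>
      mul_nonpos_of_nonneg_of_nonpos (hopt.1 i k) (scaConstraint_self_nonpos hσ (hz.1 i k))
  have hle := hy z
  simp only [lagrangian] at hle
  have h0 : power (z - y) = 0 := le_antisymm (by linarith) (power_nonneg _)
  rw [sub_eq_zero.1 (power_eq_zero h0)] at hcov ⊢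
  exact hcov j

/-- The optimal multipliers, read off with a family biorthogonal to the channels. -/
lemma IsQoSOptimal.star_dotProduct_eq (hγ : ∀ i k, 0 < γ i k) (hσ : 0 < σ)
    (hz : IsQoSOptimal h γ σ z) (hopt : IsDualOptimal h γ σ z lam)
    {d : (i : Fin G) × Fin (K i) → Fin N → ℂ}
    (hd : ∀ u v, star (d u) ⬝ᵥ userChannel h v = if v = u then 1 else 0)
    (u : (i : Fin G) × Fin (K i)) :
    star (d u) ⬝ᵥ z u.1 = (lam u.1 u.2 : ℂ) * (star (userChannel h u) ⬝ᵥ z u.1) := by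
  have h1 := congrArg (fun x => star (d u) ⬝ᵥ x) (hz.stationary hγ hσ hopt u.1)
  have h2 : star (d u) ⬝ᵥ matchedSum h z lam u.1 =
      (lam u.1 u.2 : ℂ) * (star (userChannel h u) ⬝ᵥ z u.1) := by
    rw [matchedSum, dotProduct_sum, Finset.sum_eq_single u.2]
    · rw [dotProduct_smul]
      have := hd u u
      rw [if_pos rfl] at this
      rw [show h u.1 u.2 = userChannel h u from rfl, this, smul_eq_mul, mul_one]
    · intro k _ hk
      have := hd u ⟨u.1, k⟩
      rw [if_neg (fun hu => hk (by
        obtain ⟨_, _⟩ := u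
        exact eq_of_heq (Sigma.mk.inj hu).2))] at this
      rw [dotProduct_smul, show h u.1 k = userChannel h ⟨u.1, k⟩ from rfl, this, smul_zero]
    · simp
  rw [← h2, ← h1, weightedCov_mulVec]
  simp [dotProduct_add, dotProduct_sum, dotProduct_smul, hd, leakWeight]

end Duality

section Boundedness

variable {G : ℕ} {K : Fin G → ℕ} {N : ℕ} {h : (i : Fin G) → Fin (K i) → Fin N → ℂ}
  {γ : (i : Fin G) → Fin (K i) → ℝ} {σ : ℝ} {w : Fin G → Fin N → ℂ}

lemma IsQoSOptimal.le_norm_sq (hγ : ∀ i k, 0 < γ i k) (hσ : 0 < σ) (hw : IsQoSOptimal h γ σ w)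
    (u : (i : Fin G) × Fin (K i)) :
    γ u.1 u.2 * σ ^ 2 ≤ ‖star (userChannel h u) ⬝ᵥ w u.1‖ ^ 2 := by
  have h1 := (le_sinr_iff hσ).1 (hw.1 u.1 u.2)
  have h2 := mul_nonneg (hγ u.1 u.2).le (interference_nonneg (h := h) w u.1 u.2)
  rw [norm_star_dotProduct_comm, userChannel]
  linarith

/-- First- and second-order variation of the power when all signals received by user `u` are
replaced by the interference-free ones. -/
lemma IsQoSOptimal.variation_nonneg (hγ : ∀ i k, 0 < γ i k) (hσ : 0 < σ)
    (hw : IsQoSOptimal h γ σ w) {d : (i : Fin G) × Fin (K i) → Fin N → ℂ}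
    (hd : ∀ u v, star (userChannel h v) ⬝ᵥ d u = if v = u then 1 else 0)
    (u : (i : Fin G) × Fin (K i)) {t e : Fin G → ℂ}
    (ht : ∀ i, t i = if i = u.1 then ((σ * √(γ u.1 u.2) : ℝ) : ℂ) else 0)
    (he : ∀ i, e i = t i - star (userChannel h u) ⬝ᵥ w i) :
    0 ≤ ∑ i, (2 * (star (e i) * (star (d u) ⬝ᵥ w i)).re + ‖e i‖ ^ 2 * energy (d u)) := by
  set w' : Fin G → Fin N → ℂ := fun i => w i + e i • d u with hw'
  have hne : ∀ v, v ≠ u → ∀ i, star (userChannel h v) ⬝ᵥ w' i = star (userChannel h v) ⬝ᵥ w i :=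
    fun v hv i => by simp [hw', dotProduct_add, dotProduct_smul, hd, hv]
  have heq : ∀ i, star (userChannel h u) ⬝ᵥ w' i = t i := fun i => by
    simp [hw', dotProduct_add, dotProduct_smul, hd, he]
  have hnorm : ∀ (x : Fin G → Fin N → ℂ) (v : (i : Fin G) × Fin (K i)) i,
      ‖star (x i) ⬝ᵥ h v.1 v.2‖ = ‖star (userChannel h v) ⬝ᵥ x i‖ := fun x v i =>
    norm_star_dotProduct_comm _ _
  have hfeas : ∀ v : (i : Fin G) × Fin (K i), γ v.1 v.2 ≤ sinr h σ w' v.1 v.2 := fun v => by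
    rw [le_sinr_iff hσ, interference]
    simp only [hnorm]
    by_cases hv : v = u
    · subst hv
      have h0 : ∑ j ∈ Finset.univ.erase v.1, ‖star (userChannel h v) ⬝ᵥ w' j‖ ^ 2 = 0 :=
        Finset.sum_eq_zero fun j hj => by simp [heq, ht, Finset.ne_of_mem_erase hj]
      rw [h0, heq, ht, if_pos rfl, Complex.norm_real, Real.norm_eq_abs, sq_abs, mul_pow,
        Real.sq_sqrt (hγ _ _).le]
      linarith
    · simp only [hne v hv]
      have h1 := (le_sinr_iff hσ).1 (hw.1 v.1 v.2)
      rw [interference] at h1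
      simpa only [hnorm] using h1
  have hp := hw.2 w' fun i k => hfeas ⟨i, k⟩
  rw [power_eq, power_eq, ← sub_nonneg, ← Finset.sum_sub_distrib] at hp
  refine hp.trans (le_of_eq (Finset.sum_congr rfl fun i _ => ?_))
  have h1 : (star (w i) ⬝ᵥ (e i • d u)).re = (star (e i) * (star (d u) ⬝ᵥ w i)).re := by
    rw [dotProduct_smul, star_dotProduct_comm (w i), smul_eq_mul]
    simp only [Complex.mul_re, Complex.star_def, Complex.conj_re, Complex.conj_im]
    ring
  simp only [hw']
  rw [energy_add, energy_smul, h1]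
  ring

/-- If the channels are nearly orthogonal then the received signals of an optimal solution of the
QoS problem are bounded in terms of the SINR targets and the noise. -/
lemma IsQoSOptimal.norm_sq_le (hγ : ∀ i k, 0 < γ i k) (hσ : 0 < σ) (hw : IsQoSOptimal h γ σ w)
    (hs : ∀ u, 0 < energy (userChannel h u)) (hM : IsUnit (normGram (userChannel h)).det)
    {ε : ℝ} (hε : ∀ u v, ‖(normGram (userChannel h))⁻¹ u v -
      (1 : Matrix ((i : Fin G) × Fin (K i)) _ ℂ) u v‖ ≤ ε)
    (hsmall : G * (ε * (2 * Fintype.card ((i : Fin G) × Fin (K i)) + 1)) ≤ 1 / 4)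
    {τ : ℝ} (hτ0 : 0 ≤ τ) (hτ : ∀ i k, γ i k * σ ^ 2 ≤ τ ^ 2)
    (i : Fin G) (u : (i : Fin G) × Fin (K i)) :
    ‖star (userChannel h u) ⬝ᵥ w i‖ ^ 2 ≤ 3 * τ ^ 2 := by
  have : Nonempty (Fin G × ((i : Fin G) × Fin (K i))) := ⟨(i, u)⟩
  set b : (i : Fin G) × Fin (K i) → Fin G → ℂ := fun v j => star (userChannel h v) ⬝ᵥ w j with hb
  obtain ⟨⟨j₀, v₀⟩, hmax⟩ := Finite.exists_max
    fun p : Fin G × ((i : Fin G) × Fin (K i)) => ‖b p.2 p.1‖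
  set B := ‖b v₀ j₀‖ with hB
  have hbB : ∀ v j, ‖b v j‖ ≤ B := fun v j => hmax (j, v)
  have hB0 : 0 ≤ B := norm_nonneg _
  suffices hBτ : B ^ 2 ≤ 3 * τ ^ 2 from
    (pow_le_pow_left₀ (norm_nonneg _) (hbB u i) 2).trans hBτ
  have hε0 : 0 ≤ ε := (norm_nonneg _).trans (hε u u)
  set n : ℝ := ((Fintype.card ((i : Fin G) × Fin (K i)) : ℕ) : ℝ) with hn
  have hn0 : 0 ≤ n := Nat.cast_nonneg _
  set E := (normGram (userChannel h))⁻¹ with hE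
  set s := energy (userChannel h v₀) with hs0
  have hspos : 0 < s := hs v₀
  set d := dualVec (userChannel h) with hd
  set t : Fin G → ℂ := fun j => if j = v₀.1 then ((σ * √(γ v₀.1 v₀.2) : ℝ) : ℂ) else 0 with ht
  set e : Fin G → ℂ := fun j => t j - b v₀ j with he
  have hvar := hw.variation_nonneg hγ hσ (star_dotProduct_dualVec hs hM) v₀ (t := t) (e := e)
    (fun _ => rfl) (fun _ => rfl)
  have ht2 : ‖((σ * √(γ v₀.1 v₀.2) : ℝ) : ℂ)‖ ^ 2 ≤ τ ^ 2 := by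
    rw [Complex.norm_real, Real.norm_eq_abs, sq_abs, mul_pow, Real.sq_sqrt (hγ _ _).le, mul_comm]
    exact hτ _ _
  have htτ : ∀ j, ‖t j‖ ≤ τ := fun j => by
    simp only [ht]
    split_ifs
    · exact le_of_sq_le_sq ht2 hτ0
    · simpa using hτ0
  have hsumt : ∑ j, ‖t j‖ ^ 2 ≤ τ ^ 2 := by
    rw [Finset.sum_eq_single v₀.1 (fun j _ hj => by simp [ht, hj]) (by simp)]
    exact pow_le_pow_left₀ (norm_nonneg _) (htτ _) 2
  have heB : ∀ j, ‖e j‖ ≤ τ + B := fun j =>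
    (norm_sub_le _ _).trans (add_le_add (htτ j) (hbB v₀ j))
  have hterm : ∀ j, s * (2 * (star (e j) * (star (d v₀) ⬝ᵥ w j)).re + ‖e j‖ ^ 2 * energy (d v₀)) ≤
      ‖t j‖ ^ 2 - ‖b v₀ j‖ ^ 2 + ε * (2 * n + 1) * (τ + B) ^ 2 := fun j => by
    set r := ∑ v, (E v₀ v - (1 : Matrix ((i : Fin G) × Fin (K i)) _ ℂ) v₀ v) * b v j with hr
    have h1 : (s : ℂ) * (star (d v₀) ⬝ᵥ w j) = b v₀ j + r := by
      rw [hs0, energy_mul_star_dualVec_dotProduct hs, hr]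
      simp [sub_mul, Finset.sum_sub_distrib, Matrix.one_apply, hb, hE]
    have hrn : ‖r‖ ≤ n * (ε * (τ + B)) := by
      refine (norm_sum_le _ _).trans ?_
      rw [hn, ← nsmul_eq_mul, ← Finset.card_univ]
      refine Finset.sum_le_card_nsmul _ _ _ fun v _ => ?_
      rw [norm_mul]
      exact mul_le_mul (hε v₀ v) ((hbB v j).trans (by linarith)) (norm_nonneg _) hε0
    have h2 : s * energy (d v₀) ≤ 1 + ε := by
      have h3 := energy_mul_energy_dualVec hs hM v₀
      have h4 := hε v₀ v₀
      rw [← hE] at h3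
      rw [← h3, Matrix.one_apply_eq, ← Complex.ofReal_one, ← Complex.ofReal_sub,
        Complex.norm_real] at h4
      have := (le_abs_self _).trans h4
      linarith
    have h5 : s * (star (e j) * (star (d v₀) ⬝ᵥ w j)).re =
        (star (b v₀ j) * e j).re + (star (e j) * r).re := by
      rw [← Complex.re_ofReal_mul, mul_left_comm, h1, mul_add, Complex.add_re]
      congr 1
      simp only [Complex.mul_re, Complex.star_def, Complex.conj_re, Complex.conj_im]
      ring
    have h6 : ‖t j‖ ^ 2 = ‖b v₀ j‖ ^ 2 + 2 * (star (b v₀ j) * e j).re + ‖e j‖ ^ 2 := by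
      rw [← norm_add_sq_complex]
      simp [he]
    have h7 : (star (e j) * r).re ≤ (τ + B) * (n * (ε * (τ + B))) := by
      refine (Complex.re_le_norm _).trans ?_
      rw [norm_mul, norm_star]
      exact mul_le_mul (heB j) hrn (norm_nonneg _) (by positivity)
    have h8 : ‖e j‖ ^ 2 * (s * energy (d v₀)) ≤ ‖e j‖ ^ 2 * (1 + ε) :=
      mul_le_mul_of_nonneg_left h2 (by positivity)
    have h9 : ‖e j‖ ^ 2 * ε ≤ (τ + B) ^ 2 * ε :=
      mul_le_mul_of_nonneg_right (pow_le_pow_left₀ (norm_nonneg _) (heB j) 2) hε0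
    linarith
  have hsum := (mul_nonneg hspos.le hvar)
  rw [Finset.mul_sum] at hsum
  replace hsum := hsum.trans (Finset.sum_le_sum fun j _ => hterm j)
  rw [Finset.sum_add_distrib, Finset.sum_sub_distrib, Finset.sum_const, Finset.card_univ,
    Fintype.card_fin, nsmul_eq_mul] at hsum
  have hBsum : B ^ 2 ≤ ∑ j, ‖b v₀ j‖ ^ 2 :=
    Finset.single_le_sum (f := fun j => ‖b v₀ j‖ ^ 2) (fun _ _ => by positivity)
      (Finset.mem_univ j₀)
  have hfin : G * (ε * (2 * n + 1) * (τ + B) ^ 2) ≤ 1 / 4 * (τ + B) ^ 2 := by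
    rw [← mul_assoc]
    exact mul_le_mul_of_nonneg_right hsmall (by positivity)
  nlinarith [sq_nonneg (τ - B)]

end Boundedness

section Residual

variable {G : ℕ} {K : Fin G → ℕ} {N : ℕ}

lemma optimalityResidual_apply (h : (i : Fin G) → Fin (K i) → Fin N → ℂ)
    (γ lam : (i : Fin G) → Fin (K i) → ℝ) (i : Fin G) (δ : Fin (K i) → ℂ) (k : Fin (K i)) :
    optimalityResidual h γ lam i δ k = ∑ l, ((star (userChannel h ⟨i, k⟩) ⬝ᵥ
      (weightedCov (userChannel h) fun u => lam u.1 u.2 * γ u.1 u.2)⁻¹.mulVec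
        (userChannel h ⟨i, l⟩)) * ((lam i l : ℂ) * (1 + γ i l)) -
      if (⟨i, k⟩ : (i : Fin G) × Fin (K i)) = ⟨i, l⟩ then 1 else 0) * δ l := by
  rw [optimalityResidual, Matrix.mulVec, dotProduct]
  refine Finset.sum_congr rfl fun l _ => ?_
  congr 1
  have h1 : ((1 : Matrix (Fin (K i)) (Fin (K i)) ℂ) + Matrix.diagonal fun k => (γ i k : ℂ)) =
      Matrix.diagonal fun k => 1 + (γ i k : ℂ) := by
    rw [← Matrix.diagonal_one, Matrix.diagonal_add]
  rw [h1, Matrix.sub_apply, Matrix.mul_diagonal, Matrix.mul_diagonal, Matrix.mul_assoc,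
    covMatrix_eq, mul_assoc, Matrix.one_apply]
  congr 1
  simp

end Residual

section Asymptotics

variable {G : ℕ} {K : Fin G → ℕ} {h : (N : ℕ) → (i : Fin G) → Fin (K i) → Fin N → ℂ}
  {γ : (i : Fin G) → Fin (K i) → ℝ} {σ : ℝ} {w : (N : ℕ) → Fin G → Fin N → ℂ}

lemma exists_eventually_norm_le (hγ : ∀ i k, 0 < γ i k) (hσ : 0 < σ)
    (hs : ∀ᶠ N in atTop, ∀ u, 0 < energy (userChannel (h N) u))
    (hM : Tendsto (fun N => normGram (userChannel (h N))) atTop (𝓝 1))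
    (hw : ∀ᶠ N in atTop, IsQoSOptimal (h N) γ σ (w N)) :
    ∃ C, ∀ᶠ N in atTop, ∀ i u, ‖star (userChannel (h N) u) ⬝ᵥ w N i‖ ≤ C := by
  set c : ℝ := G * (2 * Fintype.card ((i : Fin G) × Fin (K i)) + 1) with hc
  have hc0 : 0 ≤ c := by positivity
  set ε : ℝ := 1 / (4 * (c + 1)) with hε
  have hε0 : 0 < ε := by positivity
  set T : ℝ := ∑ u : (i : Fin G) × Fin (K i), γ u.1 u.2 * σ ^ 2 with hT
  have hTu : ∀ u : (i : Fin G) × Fin (K i), 0 ≤ γ u.1 u.2 * σ ^ 2 := fun u =>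
    mul_nonneg (hγ _ _).le (by positivity)
  have hT0 : 0 ≤ T := Finset.sum_nonneg fun u _ => hTu u
  have hclose : ∀ᶠ N in atTop, ∀ u v, ‖(normGram (userChannel (h N)))⁻¹ u v -
      (1 : Matrix ((i : Fin G) × Fin (K i)) _ ℂ) u v‖ ≤ ε := by
    refine eventually_all.2 fun u => eventually_all.2 fun v => ?_
    have := (tendsto_iff_norm_sub_tendsto_zero.1
      (tendsto_matrix_apply (tendsto_inv_normGram hM) u v))
    exact this.eventually_le_const hε0
  refine ⟨√(3 * T), ?_⟩
  filter_upwards [hs, eventually_isUnit_det hM, hclose, hw] with N hsN hMN hεN hwN i u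
  refine Real.le_sqrt_of_sq_le ?_
  have := hwN.norm_sq_le hγ hσ hsN hMN hεN ?_ (Real.sqrt_nonneg T) (fun i k => ?_) i u
  · rwa [Real.sq_sqrt hT0] at this
  · have h1 : G * (ε * (2 * Fintype.card ((i : Fin G) × Fin (K i)) + 1)) = ε * c := by
      rw [hc]
      ring
    rw [h1, hε, one_div_mul_eq_div, div_le_div_iff₀ (by positivity) (by norm_num)]
    linarith
  · rw [Real.sq_sqrt hT0]
    exact Finset.single_le_sum (f := fun u : (i : Fin G) × Fin (K i) => γ u.1 u.2 * σ ^ 2)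
      (fun u _ => hTu u) (Finset.mem_univ ⟨i, k⟩)

variable {lam : ℕ → (i : Fin G) → Fin (K i) → ℝ}

theorem tendsto_optimalityResidual (hγ : ∀ i k, 0 < γ i k) (hσ : 0 < σ)
    (hs : ∀ᶠ N in atTop, ∀ u, 0 < energy (userChannel (h N) u))
    (hM : Tendsto (fun N => normGram (userChannel (h N))) atTop (𝓝 1))
    (hlam : ∀ᶠ N in atTop, IsFixedPointSolution (h N) γ (lam N))
    (hw : ∀ᶠ N in atTop, IsQoSOptimal (h N) γ σ (w N)) (i : Fin G) (k : Fin (K i)) :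
    Tendsto (fun N => optimalityResidual (h N) γ (lam N) i
      (fun l => star (h N i l) ⬝ᵥ w N i) k) atTop (𝓝 0) := by
  obtain ⟨C, hC⟩ := exists_eventually_norm_le hγ hσ hs hM hw
  simp only [optimalityResidual_apply]
  refine (tendsto_finsetSum (a := fun _ => (0 : ℂ)) _ fun l _ => ?_).mono_right (by simp)
  have h1 := tendsto_mul_star_dotProduct_inv (γ := fun u : (i : Fin G) × Fin (K i) => γ u.1 u.2)
    (lam := fun N u => lam N u.1 u.2) (fun u => hγ _ _) hs hM
    (hlam.mono fun N hN => isFixedPointSolution_iff.1 hN) ⟨i, k⟩ ⟨i, l⟩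
  refine (tendsto_sub_nhds_zero_iff.2 h1).zero_mul_isBoundedUnder_le ?_
  exact isBoundedUnder_of_eventually_le (hC.mono fun N hN => hN i ⟨i, l⟩)

lemma tendsto_dualOptimal_mul_energy (hγ : ∀ i k, 0 < γ i k) (hσ : 0 < σ)
    (hs : ∀ᶠ N in atTop, ∀ u, 0 < energy (userChannel (h N) u))
    (hM : Tendsto (fun N => normGram (userChannel (h N))) atTop (𝓝 1))
    (hw : ∀ᶠ N in atTop, IsQoSOptimal (h N) γ σ (w N))
    (hopt : ∀ᶠ N in atTop, IsDualOptimal (h N) γ σ (w N) (lam N))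
    (u : (i : Fin G) × Fin (K i)) :
    Tendsto (fun N => lam N u.1 u.2 * energy (userChannel (h N) u)) atTop (𝓝 1) := by
  obtain ⟨C, hC⟩ := exists_eventually_norm_le hγ hσ hs hM hw
  set c := √(γ u.1 u.2 * σ ^ 2) with hc
  have hc0 : 0 < c := Real.sqrt_pos.2 (mul_pos (hγ _ _) (by positivity))
  have hlim : Tendsto (fun N => (∑ v, ‖(normGram (userChannel (h N)))⁻¹ u v -
      (1 : Matrix ((i : Fin G) × Fin (K i)) _ ℂ) u v‖ * C) / c) atTop (𝓝 0) := by
    have h1 : Tendsto (fun N => ∑ v, ‖(normGram (userChannel (h N)))⁻¹ u v -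
        (1 : Matrix ((i : Fin G) × Fin (K i)) _ ℂ) u v‖ * C) atTop
        (𝓝 (∑ _v : (i : Fin G) × Fin (K i), 0 * C)) :=
      tendsto_finsetSum _ fun v _ => (tendsto_iff_norm_sub_tendsto_zero.1
        (tendsto_matrix_apply (tendsto_inv_normGram hM) u v)).mul_const C
    simpa using h1.div_const c
  rw [← tendsto_sub_nhds_zero_iff]
  refine squeeze_zero_norm' ?_ hlim
  filter_upwards [hs, eventually_isUnit_det hM, hw, hopt, hC] with N hsN hMN hwN hoptN hCN
  set E := (normGram (userChannel (h N)))⁻¹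
  set b := fun v => star (userChannel (h N) v) ⬝ᵥ w N u.1 with hb
  set x := lam N u.1 u.2 * energy (userChannel (h N) u) with hx
  have h1 := hwN.star_dotProduct_eq hγ hσ hoptN (star_dualVec_dotProduct_apply hsN hMN) u
  have h2 := energy_mul_star_dualVec_dotProduct hsN u (w N u.1)
  rw [h1] at h2
  have h3 : ((x - 1 : ℝ) : ℂ) * b u =
      ∑ v, (E u v - (1 : Matrix ((i : Fin G) × Fin (K i)) _ ℂ) u v) * b v := by
    simp only [sub_mul, Finset.sum_sub_distrib, Matrix.one_apply, ite_mul, one_mul, zero_mul,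
      Finset.sum_ite_eq, Finset.mem_univ, if_true]
    rw [← h2, hx]
    push_cast
    ring
  have h4 : c ≤ ‖b u‖ := Real.sqrt_le_iff.2 ⟨norm_nonneg _, hwN.le_norm_sq hγ hσ u⟩
  rw [le_div_iff₀ hc0]
  calc ‖x - 1‖ * c ≤ ‖x - 1‖ * ‖b u‖ := mul_le_mul_of_nonneg_left h4 (norm_nonneg _)
    _ = ‖((x - 1 : ℝ) : ℂ) * b u‖ := by rw [norm_mul, Complex.norm_real]
    _ ≤ _ := by
      rw [h3]
      refine (norm_sum_le _ _).trans (Finset.sum_le_sum fun v _ => ?_)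
      rw [norm_mul]
      exact mul_le_mul_of_nonneg_left (hCN u.1 v) (norm_nonneg _)

theorem tendsto_div_dualOptimal (hγ : ∀ i k, 0 < γ i k) (hσ : 0 < σ)
    (hs : ∀ᶠ N in atTop, ∀ u, 0 < energy (userChannel (h N) u))
    (hM : Tendsto (fun N => normGram (userChannel (h N))) atTop (𝓝 1))
    (hlam : ∀ᶠ N in atTop, IsFixedPointSolution (h N) γ (lam N))
    (hw : ∀ᶠ N in atTop, IsQoSOptimal (h N) γ σ (w N))
    {lamOpt : ℕ → (i : Fin G) → Fin (K i) → ℝ}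
    (hopt : ∀ᶠ N in atTop, IsDualOptimal (h N) γ σ (w N) (lamOpt N))
    (i : Fin G) (k : Fin (K i)) :
    Tendsto (fun N => lam N i k / lamOpt N i k) atTop (𝓝 1) := by
  have h1 := tendsto_fixedPoint_mul_energy (γ := fun u : (i : Fin G) × Fin (K i) => γ u.1 u.2)
    (lam := fun N u => lam N u.1 u.2) (fun u => hγ _ _) hs hM
    (hlam.mono fun N hN => isFixedPointSolution_iff.1 hN) ⟨i, k⟩
  have h2 := tendsto_dualOptimal_mul_energy hγ hσ hs hM hw hopt ⟨i, k⟩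
  have h3 := h1.div h2 one_ne_zero
  rw [div_one] at h3
  refine h3.congr' ?_
  filter_upwards [hs] with N hN
  exact mul_div_mul_right _ _ (hN ⟨i, k⟩).ne'

lemma eventually_existsUnique_isFixedPointSolution (hγ : ∀ i k, 0 < γ i k)
    (hs : ∀ᶠ N in atTop, ∀ u, 0 < energy (userChannel (h N) u))
    (hM : Tendsto (fun N => normGram (userChannel (h N))) atTop (𝓝 1)) :
    ∀ᶠ N in atTop, ∃! lam : (i : Fin G) → Fin (K i) → ℝ, IsFixedPointSolution (h N) γ lam := by
  filter_upwards [hs, eventually_isUnit_det hM] with N hN hdet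
  obtain ⟨x, hx, huniq⟩ := existsUnique_isFixedPoint (H := userChannel (h N))
    (γ := fun u => γ u.1 u.2) (fun u => hγ _ _) (star_dotProduct_dualVec hN hdet)
  refine ⟨fun i k => x ⟨i, k⟩, isFixedPointSolution_iff.2 hx, fun lam hlam => ?_⟩
  have := huniq _ (isFixedPointSolution_iff.1 hlam)
  funext i k
  exact congrFun this ⟨i, k⟩

end Asymptotics

lemma energy_userChannel_channel {Ω : Type*} {G : ℕ} {K : Fin G → ℕ}
    (h : (i : Fin G) → Fin (K i) → ℕ → Ω → ℂ) (ω : Ω) (N : ℕ) (u : (i : Fin G) × Fin (K i)) :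
    energy (userChannel (channel h ω N) u) = ∑ n ∈ Finset.range N, ‖h u.1 u.2 n ω‖ ^ 2 :=
  Fin.sum_univ_eq_sum_range (fun n => ‖h u.1 u.2 n ω‖ ^ 2) N

lemma star_userChannel_channel_dotProduct {Ω : Type*} {G : ℕ} {K : Fin G → ℕ}
    (h : (i : Fin G) → Fin (K i) → ℕ → Ω → ℂ) (ω : Ω) (N : ℕ) (u v : (i : Fin G) × Fin (K i)) :
    star (userChannel (channel h ω N) u) ⬝ᵥ userChannel (channel h ω N) v =
      ∑ n ∈ Finset.range N, star (h u.1 u.2 n ω) * h v.1 v.2 n ω :=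
  Fin.sum_univ_eq_sum_range (fun n => star (h u.1 u.2 n ω) * h v.1 v.2 n ω) N

/-- Almost surely, the channels are asymptotically orthogonal. -/
theorem ae_tendsto_normGram {Ω : Type*} [MeasurableSpace Ω] {P : Measure Ω}
    [IsProbabilityMeasure P] {G : ℕ} {K : Fin G → ℕ}
    {h : (i : Fin G) → Fin (K i) → ℕ → Ω → ℂ} (h_meas : ∀ i k n, Measurable (h i k n))
    (h_indep : iIndepFun (fun (u : (i : Fin G) × Fin (K i)) ω (n : ℕ) => h u.1 u.2 n ω) P)
    (h_entries : ∀ i k, iIndepFun (h i k) P)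
    (h_ident : ∀ i k n, IdentDistrib (h i k n) (h i k 0) P P)
    (h_int : ∀ i k n, Integrable (h i k n) P)
    (h_mean : ∀ i k n, ∫ ω, h i k n ω ∂P = 0)
    (h_ne : ∀ i k, ¬ (h i k 0 =ᵐ[P] 0)) :
    ∀ᵐ ω ∂P, (∀ᶠ N in atTop, ∀ u, 0 < energy (userChannel (channel h ω N) u)) ∧
      Tendsto (fun N => normGram (userChannel (channel h ω N))) atTop (𝓝 1) := by
  filter_upwards [ae_tendsto_normalized_gram
    (X := fun (u : (i : Fin G) × Fin (K i)) n ω => h u.1 u.2 n ω) (fun u => h_meas u.1 u.2)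
    h_indep (fun u => h_entries u.1 u.2) (fun u => h_ident u.1 u.2) (fun u => h_int u.1 u.2)
    (fun u => h_mean u.1 u.2) (fun u => h_ne u.1 u.2)] with ω hω
  have hs : ∀ u, ∀ᶠ N in atTop, 0 < energy (userChannel (channel h ω N) u) := fun u => by
    simpa only [energy_userChannel_channel] using hω.1 u
  refine ⟨eventually_all.2 hs, tendsto_pi_nhds.2 fun u => tendsto_pi_nhds.2 fun v => ?_⟩
  by_cases huv : u = v
  · subst huv
    rw [Matrix.one_apply_eq]
    refine tendsto_const_nhds.congr' ?_
    filter_upwards [hs u] with N hN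
    rw [normGram, Matrix.of_apply, star_dotProduct_self, div_self (by exact_mod_cast hN.ne')]
  · rw [Matrix.one_apply_ne huv]
    simpa only [normGram, Matrix.of_apply, energy_userChannel_channel,
      star_userChannel_channel_dotProduct] using hω.2 u v huv

end Multicast

theorem proposition2 {Ω : Type*} [MeasurableSpace Ω] (P : Measure Ω) [IsProbabilityMeasure P]
    (G : ℕ) (K : Fin G → ℕ)
    (γ : (i : Fin G) → Fin (K i) → ℝ) (hγ : ∀ i k, 0 < γ i k)
    (σ : ℝ) (hσ : 0 < σ)
    (h : (i : Fin G) → Fin (K i) → ℕ → Ω → ℂ) (h_meas : ∀ i k n, Measurable (h i k n))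
    -- the channel vectors are independent
    (h_indep : iIndepFun (fun (u : (i : Fin G) × Fin (K i)) ω (n : ℕ) => h u.1 u.2 n ω) P)
    -- the entries of each channel vector are i.i.d., integrable, of mean zero
    (h_entries : ∀ i k, iIndepFun (h i k) P)
    (h_ident : ∀ i k n, IdentDistrib (h i k n) (h i k 0) P P)
    (h_int : ∀ i k n, Integrable (h i k n) P)
    (h_mean : ∀ i k n, ∫ ω, h i k n ω ∂P = 0)
    -- no channel vanishes identically
    (h_ne : ∀ i k, ¬ (h i k 0 =ᵐ[P] 0)) :
    ∀ᵐ ω ∂P,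
      -- for large `N` the fixed-point equations have exactly one solution
      (∀ᶠ N in atTop, ∃! lam : (i : Fin G) → Fin (K i) → ℝ,
        Multicast.IsFixedPointSolution (Multicast.channel h ω N) γ lam) ∧
      ∀ (lam : ℕ → (i : Fin G) → Fin (K i) → ℝ) (w : (N : ℕ) → Fin G → Fin N → ℂ),
        (∀ᶠ N in atTop,
          Multicast.IsFixedPointSolution (Multicast.channel h ω N) γ (lam N)) →
        (∀ᶠ N in atTop, Multicast.IsQoSOptimal (Multicast.channel h ω N) γ σ (w N)) →
        -- the solution asymptotically satisfies the optimality condition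
        (∀ i k, Tendsto (fun N => Multicast.optimalityResidual (Multicast.channel h ω N) γ (lam N) i
            (fun l => star (Multicast.channel h ω N i l) ⬝ᵥ w N i) k) atTop (𝓝 0)) ∧
        -- and it is asymptotically equal to the optimal dual solution
        (∀ lamOpt : ℕ → (i : Fin G) → Fin (K i) → ℝ,
          (∀ᶠ N in atTop,
            Multicast.IsDualOptimal (Multicast.channel h ω N) γ σ (w N) (lamOpt N)) →
          ∀ i k, Tendsto (fun N => lam N i k / lamOpt N i k) atTop (𝓝 1)) := by
  filter_upwards [Multicast.ae_tendsto_normGram h_meas h_indep h_entries h_ident h_int h_mean h_ne]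
    with ω hω
  exact ⟨Multicast.eventually_existsUnique_isFixedPointSolution hγ hω.1 hω.2,
    fun lam w hlam hw =>
      ⟨Multicast.tendsto_optimalityResidual hγ hσ hω.1 hω.2 hlam hw,
        fun lamOpt hopt => Multicast.tendsto_div_dualOptimal hγ hσ hω.1 hω.2 hlam hw hopt⟩⟩
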